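/- **Setting.** A transmitter with $L\ge 1$ antennas and a library of $N$ files of $B$ bits each serves $K_1\ge 1$ cache-aided users and $K_2\ge 0$ cache-less users, $N\ge K_1+K_2$. *Uncoded placement:* before the demands are known, each cache-aided user stores at most $\gamma_1NB$ of the library's bits, copied as they are, where $0<\gamma_1<1$ and $K_1\gamma_1$ is an integer; cache-less users store nothing. Then the users request pairwise different files, and in each of $n$ channel uses the transmitter sends a vector $\mathbf x\in\mathbb C^L$, an arbitrary function of the library and the demands, with $\mathbb E\|\mathbf x\|^2\le P$ (uniformly distributed files); user $k$ receives $y_k=\mathbf h_k^H\mathbf x+w_k$, where $w_k\sim\mathbb{C}\mathcal N(0,1)$ is independent over users and channel uses, and estimates its file from its received signal and its cache. The channel vectors $\mathbf h_k\in\mathbb C^L$ are fixed, known to all, and any $L$ of them are linearly independent. A delay $\Delta$ is *achievable at SNR $P$* if for every $\varepsilon>0$ there is, for some $B\ge 1$ and $n$, such a scheme for which, for every choice of pairwise different demands, the probability that some user errs is at most $\varepsilon$, and $n\log_2 P/B\le\Delta$. The *optimal delay under uncoded placement*, $T_L(K_1,\gamma_1,K_2)$, is the limit as $P\to\infty$ of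 the infimum of the delays achievable at SNR $P$. **Theorem 3.** Let $T_{K_1}=\dfrac{K_1(1-\gamma_1)}{1+K_1\gamma_1}$, let $\tilde L$ be a real number with $K_2=(\tilde L-1)T_{K_1}$, and let $L$ be an integer with $1\le L\le\tilde L$. If $L\ge 2$, assume that $T_{K_1}\tilde L\ge L$. Then the optimal delays under uncoded placement of the single-antenna and of the $L$-antenna channel with these users exist and satisfy $$T_1(K_1,\gamma_1,K_2)=L\cdot T_L(K_1,\gamma_1,K_2),\qquad T_L(K_1,\gamma_1,K_2)=T_{K_1}\frac{\tilde L}{L}.$$ -/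

import Mathlib

open MeasureTheory ProbabilityTheory Filter

noncomputable section

namespace CacheMISO

/-- The users: `K₁` cache-aided users followed by `K₂` cache-less users. -/
abbrev User (K₁ K₂ : ℕ) : Type := Fin K₁ ⊕ Fin K₂

/-- A library of `N` files of `B` bits each. -/
abbrev Library (N B : ℕ) : Type := Fin N → Fin B → Bool

/-- Worst-case demands: every user asks for one file, different users for different files. -/
abbrev Demand (K₁ K₂ N : ℕ) : Type := User K₁ K₂ ↪ Fin N

/-- Normalized cache size of each user: `γ₁` for the cache-aided ones, `0` for the others. -/
def cacheSize (K₁ K₂ : ℕ) (γ₁ : ℝ) : User K₁ K₂ → ℝ :=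
  Sum.elim (fun _ => γ₁) (fun _ => 0)

/-- A placement-and-delivery scheme with uncoded placement, for the `L`-antenna broadcast channel,
`N` files of `B` bits, and a delivery phase of `n` channel uses.

Placement is uncoded: a cache is filled with a set of bits of the library, chosen before the
demands are revealed. Delivery is arbitrary. -/
structure UncodedScheme (K₁ K₂ N L B n : ℕ) (γ₁ : ℝ) where
  /-- which bits of the library each user stores -/
  cache : User K₁ K₂ → Finset (Fin N × Fin B)
  /-- a cache of normalized size `γ` holds at most `γ N B` bits -/
  card_cache_le : ∀ k, ((cache k).card : ℝ) ≤ cacheSize K₁ K₂ γ₁ k * (N * B)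
  /-- the transmitted vector in every channel use -/
  encode : Demand K₁ K₂ N → Library N B → Fin n → EuclideanSpace ℂ (Fin L)
  /-- the estimate of the requested file, from the received signal and the cached bits -/
  decode : Demand K₁ K₂ N → (k : User K₁ K₂) → (Fin n → ℂ) → (cache k → Bool) → Fin B → Bool
  /-- the decoders are measurable functions of the received signal -/
  measurable_decode : ∀ d k z, Measurable fun y => decode d k y z

/-- The law `ℂ𝒩(0, 1)`: independent real and imaginary parts, each of variance `1 / 2`. -/
def complexGaussian : Measure ℂ :=
  ((gaussianReal 0 (1 / 2)).prod (gaussianReal 0 (1 / 2))).map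
    fun p : ℝ × ℝ => (p.1 : ℂ) + (p.2 : ℂ) * Complex.I

/-- The law of the noise: independent `ℂ𝒩(0, 1)` over users and channel uses. -/
def noise (K₁ K₂ n : ℕ) : Measure (User K₁ K₂ → Fin n → ℂ) :=
  Measure.pi fun _ => Measure.pi fun _ => complexGaussian

namespace UncodedScheme

variable {K₁ K₂ N L B n : ℕ} {γ₁ : ℝ}

/-- The received signal `y_k = h_kᴴ x + w_k` of user `k`, in each channel use. -/
def received (S : UncodedScheme K₁ K₂ N L B n γ₁)
    (h : User K₁ K₂ → EuclideanSpace ℂ (Fin L)) (d : Demand K₁ K₂ N) (W : Library N B)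
    (w : User K₁ K₂ → Fin n → ℂ) (k : User K₁ K₂) : Fin n → ℂ :=
  fun t => inner ℂ (h k) (S.encode d W t) + w k t

/-- For library `W` and noise `w`, every user recovers exactly the file it asked for. -/
def Succeeds (S : UncodedScheme K₁ K₂ N L B n γ₁)
    (h : User K₁ K₂ → EuclideanSpace ℂ (Fin L)) (d : Demand K₁ K₂ N) (W : Library N B)
    (w : User K₁ K₂ → Fin n → ℂ) : Prop :=
  ∀ k, S.decode d k (S.received h d W w k) (fun p => W p.1.1 p.1.2) = W (d k)

/-- The probability, over uniformly distributed files and the noise, that some user fails. -/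
def errorProb (S : UncodedScheme K₁ K₂ N L B n γ₁)
    (h : User K₁ K₂ → EuclideanSpace ℂ (Fin L)) (d : Demand K₁ K₂ N) : ℝ :=
  (∑ W : Library N B, (noise K₁ K₂ n).real {w | ¬ S.Succeeds h d W w}) /
    Fintype.card (Library N B)

/-- The power constraint `𝔼 ‖x‖² ≤ P`, in every channel use and for every demand, where the
files are uniformly distributed. -/
def PowerLE (S : UncodedScheme K₁ K₂ N L B n γ₁) (P : ℝ) : Prop :=
  ∀ d t, (∑ W : Library N B, ‖S.encode d W t‖ ^ 2) / Fintype.card (Library N B) ≤ P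

end UncodedScheme

/-- The delay `Δ` is achievable at signal-to-noise ratio `P` with uncoded placement: for every
`ε > 0` there is a scheme, for some positive file size `B`, that serves all worst-case demands with
error probability at most `ε` and whose delivery phase takes at most `Δ` units of time. A unit of
time is the `B / log P` channel uses that a link of capacity `log P` needs to carry one file. -/
def AchievableAt {K₁ K₂ L : ℕ} (N : ℕ) (γ₁ : ℝ)
    (h : User K₁ K₂ → EuclideanSpace ℂ (Fin L)) (P Δ : ℝ) : Prop :=
  ∀ ε : ℝ, 0 < ε → ∃ (B n : ℕ) (S : UncodedScheme K₁ K₂ N L B n γ₁), 0 < B ∧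
    S.PowerLE P ∧ (∀ d, S.errorProb h d ≤ ε) ∧ (n : ℝ) * Real.logb 2 P / B ≤ Δ

/-- `D` is the optimal (degrees-of-freedom) delay under uncoded placement: the infimum of the delays
achievable at signal-to-noise ratio `P` tends to `D` as `P → ∞`. -/
def IsOptimalDelay {K₁ K₂ L : ℕ} (N : ℕ) (γ₁ : ℝ)
    (h : User K₁ K₂ → EuclideanSpace ℂ (Fin L)) (D : ℝ) : Prop :=
  ∀ δ : ℝ, 0 < δ → ∀ᶠ P : ℝ in atTop,
    (∃ Δ, AchievableAt N γ₁ h P Δ ∧ Δ ≤ D + δ) ∧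
    (∀ Δ, AchievableAt N γ₁ h P Δ → D - δ ≤ Δ)

/-- Channel vectors in general position: those of any `L` users are linearly independent. -/
def GeneralPosition {K₁ K₂ L : ℕ} (h : User K₁ K₂ → EuclideanSpace ℂ (Fin L)) : Prop :=
  ∀ s : Finset (User K₁ K₂), s.card = L → LinearIndependent ℂ fun k : s => h k

/-- `T_K = K (1 - γ) / (1 + K γ)`. -/
def singleDelay (K : ℕ) (γ : ℝ) : ℝ := K * (1 - γ) / (1 + K * γ)

end CacheMISO

end

/-! With `M` antennas, for `M = 1` and `M = L`, the optimal delay is `(K₂ + T) / M`, where `T =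
T_{K₁}`. The relation between `K₂` and `Lt` says `K₂ + T = T * Lt`, which gives both claims. Put `t
= K₁ γ₁` and `u = K₁ - t`, so that `T = u / (t + 1)`.

Converse. Let the users decode one after another, the cache-less ones first. A requested bit is
fresh if neither its requester nor an earlier user stores it. Given the received signals, the
non-fresh bits determine the whole library (`card_decodes_mul_le`), so the signals must carry all
fresh bits. All signals are noisy images of one vector in `ℂ^L` per channel use, which carries about
`L log P` nats, however many users there are (`card_freshBits_le`). The proof is a change of
measure: the codeword is moved to a nearby lattice point, at bounded relative entropy per channel
use, and the lattice points get a prior of scale `√P`. Averaging over shifted demands and orders of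
the cache-aided users, a bit stored by `s` of them is fresh for `(K₁ - s) / (s + 1)` requesters on
average. This is convex in `s` and the mean of `s` is at most `K₁ γ₁`, so some choice leaves at
least `B (K₂ + T)` fresh bits (`exists_le_card_freshBits`).

Achievability. Packets are indexed by the `t`-sets of cache-aided users that store them. For each
`(t + 1)`-set `σ`, a stream of exclusive ors useful to all of `σ` is scheduled together with streams
to cache-less users, `L` at a time. A stream to a cache-less user carries a packet stored by all of
`σ` but one user, so nulling it at that user and at the other cache-less users in service uses
exactly the available `L - 1` zeros (`nonempty_deliveryPlan`). The two inequalities on `Lt` let a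
wrap-around schedule keep all streams busy. Each stream is protected by a block code of rate close
to `log P` (`eventually_exists_code`). -/

noncomputable section

namespace CacheMISO

/-! ### Translates of Gaussian measures -/

section Shift

/-- The translate of `μ` by `-a` has density `exp (-ℓ)`, where `∫ ℓ dμ = κ`. -/
def HasShiftEntropy {α : Type*} [MeasurableSpace α] [AddGroup α] (μ : Measure α) (a : α)
    (κ : ℝ) : Prop :=
  ∃ ℓ : α → ℝ, Measurable ℓ ∧ Integrable ℓ μ ∧ ∫ x, ℓ x ∂μ = κ ∧
    μ.map (fun x => x - a) = μ.withDensity fun x => ENNReal.ofReal (Real.exp (-ℓ x))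

theorem hasShiftEntropy_gaussianReal (a : ℝ) :
    HasShiftEntropy (gaussianReal 0 (1 / 2)) a (a ^ 2) := by
  have hv : (1 / 2 : NNReal) ≠ 0 := by norm_num
  refine ⟨fun x => 2 * a * x + a ^ 2, by fun_prop, ?_, ?_, ?_⟩
  · have h : Integrable (fun x : ℝ => x) (gaussianReal 0 (1 / 2)) :=
      (memLp_id_gaussianReal 1).integrable le_rfl
    exact (h.const_mul _).add (integrable_const _)
  · have h : Integrable (fun x : ℝ => x) (gaussianReal 0 (1 / 2)) :=
      (memLp_id_gaussianReal 1).integrable le_rfl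
    rw [integral_add (h.const_mul _) (integrable_const _), integral_const_mul,
      integral_id_gaussianReal]
    simp
  · rw [gaussianReal_map_sub_const, gaussianReal_of_var_ne_zero _ hv,
      gaussianReal_of_var_ne_zero _ hv, ← withDensity_mul _ (by fun_prop) (by fun_prop)]
    congr 1
    ext x
    simp only [Pi.mul_apply, gaussianPDF_def, gaussianPDFReal_def]
    rw [← ENNReal.ofReal_mul (by positivity), mul_assoc _ (Real.exp _), ← Real.exp_add]
    congr 3
    push_cast
    ring

/-- Densities of product measures multiply, so the exponents `ℓ` add: `κ` is a relative entropy,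
hence additive over independent coordinates. -/
theorem HasShiftEntropy.prod {α β : Type*} [MeasurableSpace α] [AddGroup α] [MeasurableSub₂ α]
    [MeasurableSpace β] [AddGroup β] [MeasurableSub₂ β]
    {μ : Measure α} {ν : Measure β} [IsProbabilityMeasure μ] [IsProbabilityMeasure ν]
    {a : α} {b : β} {κ κ' : ℝ} (hμ : HasShiftEntropy μ a κ) (hν : HasShiftEntropy ν b κ') :
    HasShiftEntropy (μ.prod ν) (a, b) (κ + κ') := by
  obtain ⟨l, hl, hli, hlκ, hlm⟩ := hμ
  obtain ⟨l', hl', hli', hlκ', hlm'⟩ := hν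
  refine ⟨fun p => l p.1 + l' p.2, by fun_prop, (hli.comp_fst ν).add (hli'.comp_snd μ), ?_, ?_⟩
  · rw [integral_add (hli.comp_fst ν) (hli'.comp_snd μ), integral_fun_fst, integral_fun_snd]
    simp [hlκ, hlκ']
  · have h1 : (fun x : α × β => x - (a, b)) = Prod.map (fun x => x - a) (fun x => x - b) := rfl
    have : IsProbabilityMeasure (μ.map (fun x => x - a)) :=
      Measure.isProbabilityMeasure_map (by fun_prop)
    have : IsProbabilityMeasure (ν.map (fun x => x - b)) :=
      Measure.isProbabilityMeasure_map (by fun_prop)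
    rw [h1, ← Measure.map_prod_map _ _ (by fun_prop) (by fun_prop), hlm, hlm']
    rw [prod_withDensity (by fun_prop) (by fun_prop)]
    congr 1
    ext p
    rw [← ENNReal.ofReal_mul (by positivity), ← Real.exp_add]
    congr 2
    ring

theorem withDensity_pi {ι : Type*} [Fintype ι] {α : ι → Type*} [∀ i, MeasurableSpace (α i)]
    (μ : ∀ i, Measure (α i)) [∀ i, IsProbabilityMeasure (μ i)] (f : ∀ i, α i → ENNReal)
    (hf : ∀ i, Measurable (f i)) [∀ i, SigmaFinite ((μ i).withDensity (f i))] :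
    (Measure.pi μ).withDensity (fun x => ∏ i, f i (x i)) =
      Measure.pi fun i => (μ i).withDensity (f i) := by
  symm
  refine Measure.pi_eq fun s hs => ?_
  have hms : ∀ i, Measurable ((s i).indicator (f i)) := fun i => (hf i).indicator (hs i)
  rw [withDensity_apply _ (MeasurableSet.univ_pi hs), ← lintegral_indicator
    (MeasurableSet.univ_pi hs)]
  have h1 : (Set.univ.pi s).indicator (fun x => ∏ i, f i (x i)) =
      fun x => ∏ i, (s i).indicator (f i) (x i) := by
    classical
    ext x
    simp only [Set.indicator_apply, Set.mem_univ_pi]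
    split_ifs with h
    · exact Finset.prod_congr rfl fun i _ => by simp [h i]
    · push Not at h
      obtain ⟨i, hi⟩ := h
      exact (Finset.prod_eq_zero (Finset.mem_univ i) (by simp [hi])).symm
  rw [h1, lintegral_prod_eq_prod_lintegral_of_indepFun Finset.univ
    (fun i (x : ∀ i, α i) => (s i).indicator (f i) (x i))
    (iIndepFun_pi fun i => (hms i).aemeasurable) (fun i => (hms i).comp (measurable_pi_apply i))]
  refine Finset.prod_congr rfl fun i _ => ?_
  rw [withDensity_apply _ (hs i), ← lintegral_indicator (hs i),
    ← (measurePreserving_eval μ i).lintegral_comp (hms i)]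

theorem HasShiftEntropy.pi {ι : Type*} [Fintype ι] {α : ι → Type*} [∀ i, MeasurableSpace (α i)]
    [∀ i, AddGroup (α i)] [∀ i, MeasurableSub₂ (α i)]
    {μ : ∀ i, Measure (α i)} [∀ i, IsProbabilityMeasure (μ i)] {a : ∀ i, α i} {κ : ι → ℝ}
    (h : ∀ i, HasShiftEntropy (μ i) (a i) (κ i)) :
    HasShiftEntropy (Measure.pi μ) a (∑ i, κ i) := by
  choose l hl hli hlκ hlm using h
  have hint : ∀ i, Integrable (fun x : ∀ i, α i => l i (x i)) (Measure.pi μ) :=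
    fun i => integrable_comp_eval (hli i)
  have hprob : ∀ i, IsProbabilityMeasure ((μ i).map (fun x => x - a i)) := fun i =>
    Measure.isProbabilityMeasure_map (by fun_prop)
  refine ⟨fun x => ∑ i, l i (x i), by fun_prop, integrable_finsetSum _ fun i _ => hint i, ?_, ?_⟩
  · rw [integral_finsetSum _ fun i _ => hint i]
    exact Finset.sum_congr rfl fun i _ => by
      rw [integral_comp_eval (hl i).aestronglyMeasurable, hlκ]
  · have h1 : (fun x : ∀ i, α i => x - a) = fun x i => x i - a i := rfl
    rw [h1, Measure.pi_map_pi (f := fun i x => x - a i) (fun i => by fun_prop)]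
    have h2 : ∀ i, SigmaFinite ((μ i).withDensity fun x => ENNReal.ofReal (Real.exp (-l i x))) :=
      fun i => by rw [← hlm]; infer_instance
    have h3 : (fun i => (μ i).map (fun x => x - a i)) =
      fun i => (μ i).withDensity fun x => ENNReal.ofReal (Real.exp (-l i x)) := funext hlm
    rw [h3, ← withDensity_pi _ _ (fun i => by fun_prop)]
    congr 1
    ext x
    rw [← ENNReal.ofReal_prod_of_nonneg (fun _ _ => by positivity), ← Real.exp_sum,
      Finset.sum_neg_distrib]

theorem HasShiftEntropy.map {α β : Type*} [MeasurableSpace α] [AddGroup α] [MeasurableSub₂ α]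
    [MeasurableSpace β] [AddGroup β] [MeasurableSub₂ β] {μ : Measure α} {a : α} {κ : ℝ}
    (h : HasShiftEntropy μ a κ) (e : α ≃ᵐ β) (he : ∀ x y, e (x - y) = e x - e y) :
    HasShiftEntropy (μ.map e) (e a) κ := by
  obtain ⟨l, hl, hli, hlκ, hlm⟩ := h
  refine ⟨l ∘ e.symm, hl.comp e.symm.measurable, ?_, ?_, ?_⟩
  · rw [integrable_map_equiv]
    simpa [Function.comp_def] using hli
  · rw [integral_map_equiv]
    simpa using hlκ
  · rw [Measure.map_map (by fun_prop) e.measurable]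
    have h1 : (fun x => x - e a) ∘ e = e ∘ fun x => x - a := by
      ext x; simp [he]
    rw [h1, ← Measure.map_map e.measurable (by fun_prop), hlm]
    ext s hs
    rw [e.map_apply, withDensity_apply _ (e.measurable hs), withDensity_apply _ hs,
      ← lintegral_indicator hs, lintegral_map_equiv, ← lintegral_indicator (e.measurable hs)]
    congr 1
    ext x
    by_cases hx : e x ∈ s
    · rw [Set.indicator_of_mem hx, Set.indicator_of_mem (by exact hx)]
      simp
    · rw [Set.indicator_of_notMem hx, Set.indicator_of_notMem (by exact hx)]

instance : IsProbabilityMeasure complexGaussian :=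
  Measure.isProbabilityMeasure_map (by fun_prop)

instance (K₁ K₂ n : ℕ) : IsProbabilityMeasure (noise K₁ K₂ n) := by
  unfold noise; infer_instance

theorem hasShiftEntropy_complexGaussian (a : ℂ) :
    HasShiftEntropy complexGaussian a (‖a‖ ^ 2) := by
  have h := ((hasShiftEntropy_gaussianReal a.re).prod (hasShiftEntropy_gaussianReal a.im)).map
    Complex.measurableEquivRealProd.symm (fun x y => by
      apply Complex.ext <;> simp [Complex.measurableEquivRealProd])
  have h1 : Complex.measurableEquivRealProd.symm (a.re, a.im) = a := by
    apply Complex.ext <;> simp [Complex.measurableEquivRealProd]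
  have h2 : (⇑Complex.measurableEquivRealProd.symm : ℝ × ℝ → ℂ) =
      fun p => (p.1 : ℂ) + (p.2 : ℂ) * Complex.I := by
    ext p
    apply Complex.ext <;> simp [Complex.measurableEquivRealProd]
  rw [h1, h2] at h
  rw [complexGaussian, Complex.sq_norm, Complex.normSq_apply]
  convert h using 1
  ring

theorem hasShiftEntropy_noise {K₁ K₂ n : ℕ} (a : User K₁ K₂ → Fin n → ℂ) :
    HasShiftEntropy (noise K₁ K₂ n) a (∑ k, ∑ t, ‖a k t‖ ^ 2) :=
  HasShiftEntropy.pi fun k => HasShiftEntropy.pi fun t => hasShiftEntropy_complexGaussian (a k t)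

/-- A variational (Donsker–Varadhan) bound: an event of large probability under `μ` whose
translate is unlikely forces the shift entropy to be large. -/
theorem HasShiftEntropy.integral_le {α : Type*} [MeasurableSpace α] [AddGroup α]
    [MeasurableSub₂ α] {μ : Measure α} [IsProbabilityMeasure μ] {a : α} {κ : ℝ}
    (h : HasShiftEntropy μ a κ) {f : α → ℝ} (hf : Measurable f) {C : ℝ} (hC : ∀ x, |f x| ≤ C)
    {G : ℝ} (hG : 0 < G) :
    ∫ x, f x ∂μ - κ + Real.log G ≤ G * ∫ x, Real.exp (f (x - a)) ∂μ - 1 := by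
  obtain ⟨l, hl, hli, hlκ, hlm⟩ := h
  have hfi : Integrable f μ := Integrable.of_bound hf.aestronglyMeasurable C
    (Eventually.of_forall fun x => by simpa using hC x)
  have hexp : Integrable (fun x => Real.exp (f x)) (μ.map fun x => x - a) := by
    have : IsProbabilityMeasure (μ.map (fun x => x - a)) :=
      Measure.isProbabilityMeasure_map (by fun_prop)
    refine Integrable.of_bound (by fun_prop) (Real.exp C) (Eventually.of_forall fun x => ?_)
    rw [Real.norm_eq_abs, abs_of_pos (Real.exp_pos _)]
    exact Real.exp_le_exp.2 ((le_abs_self _).trans (hC x))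
  have e1 : ∫ x, Real.exp (f (x - a)) ∂μ = ∫ x, Real.exp (-l x) * Real.exp (f x) ∂μ := by
    rw [← integral_map (f := fun x => Real.exp (f x)) (by fun_prop) (by fun_prop), hlm,
      integral_withDensity_eq_integral_toReal_smul (by fun_prop) (by simp)]
    simp [Real.exp_nonneg]
  have hi2 : Integrable (fun x => Real.exp (-l x) * Real.exp (f x)) μ := by
    rw [hlm, integrable_withDensity_iff_integrable_smul' (by fun_prop) (by simp)] at hexp
    simpa [Real.exp_nonneg] using hexp
  rw [e1]
  -- The inequality `s + 1 ≤ exp s` at `s = f x - l x + log G`, integrated.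
  have key : ∫ x, (f x - l x + Real.log G) ∂μ ≤
      ∫ x, (G * (Real.exp (-l x) * Real.exp (f x)) - 1) ∂μ := by
    refine integral_mono ((hfi.sub hli).add (integrable_const _))
      ((hi2.const_mul _).sub (integrable_const _)) fun x => ?_
    have := Real.add_one_le_exp (f x - l x + Real.log G)
    rw [Real.exp_add, Real.exp_log hG, sub_eq_add_neg, Real.exp_add] at this
    simp only
    linarith
  rw [integral_add (f := fun x => f x - l x) (hfi.sub hli) (integrable_const _), integral_sub hfi hli, hlκ,
    integral_sub (hi2.const_mul _) (integrable_const _), integral_const_mul] at key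
  simpa using key

end Shift

/-! ### A lattice prior for quantized codewords -/

section Prior

/-- Two geometric series of ratio `r = exp (-1 / S) ≤ S / (S + 1)`, one for each sign, each with sum
at most `(1 - r)⁻¹ ≤ S + 1`. -/
theorem sum_exp_neg_abs_le {S : ℝ} (hS : 0 < S) (s : Finset ℤ) :
    ∑ z ∈ s, Real.exp (-|(z : ℝ)| / S) ≤ 2 * (S + 1) := by
  set r := Real.exp (-1 / S) with hr
  have hr0 : 0 < r := Real.exp_pos _
  have hr1 : r ≤ S / (S + 1) := by
    have h1 : 1 / S + 1 ≤ Real.exp (1 / S) := Real.add_one_le_exp _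
    have h2 : r = (Real.exp (1 / S))⁻¹ := by rw [← Real.exp_neg, hr]; ring_nf
    rw [h2]
    have h3 : S / (S + 1) = (1 / S + 1)⁻¹ := by field_simp; ring
    rw [h3]
    exact inv_anti₀ (by positivity) h1
  have hr2 : r < 1 := hr1.trans_lt (by rw [div_lt_one (by positivity)]; linarith)
  have hterm : ∀ z : ℤ, Real.exp (-|(z : ℝ)| / S) = r ^ z.natAbs := by
    intro z
    rw [hr, ← Real.exp_nat_mul, Nat.cast_natAbs, Int.cast_abs]
    ring_nf
  have hgeom : (1 - r)⁻¹ ≤ S + 1 := by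
    rw [inv_le_comm₀ (by linarith) (by positivity)]
    have : (S + 1)⁻¹ = 1 - S / (S + 1) := by field_simp; ring
    linarith
  have hpart : ∀ u : Finset ℤ, Set.InjOn Int.natAbs (u : Set ℤ) →
      ∑ z ∈ u, r ^ z.natAbs ≤ S + 1 := by
    intro u hu
    rw [← Finset.sum_image (f := fun m : ℕ => r ^ m) hu]
    refine le_trans ?_ hgeom
    rw [← tsum_geometric_of_lt_one hr0.le hr2]
    exact (summable_geometric_of_lt_one hr0.le hr2).sum_le_tsum _ fun _ _ => by positivity
  simp_rw [hterm]
  rw [← Finset.sum_filter_add_sum_filter_not s (fun z => 0 ≤ z), two_mul]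
  refine add_le_add (hpart _ ?_) (hpart _ ?_)
  · intro a ha b hb hab
    simp at ha hb
    omega
  · intro a ha b hb hab
    simp at ha hb
    omega

/-- A two-sided geometric (sub-)probability on the integers, of scale `S`. -/
def latticePrior (S : ℝ) (z : ℤ) : ℝ := Real.exp (-|(z : ℝ)| / S) / (2 * (S + 1))

theorem latticePrior_pos {S : ℝ} (hS : 0 < S) (z : ℤ) : 0 < latticePrior S z := by
  unfold latticePrior; positivity

theorem sum_prod_latticePrior_le_one {S : ℝ} (hS : 0 < S) {ι : Type*} [Fintype ι]
    (X : Finset (ι → ℤ)) : ∑ z ∈ X, ∏ i, latticePrior S (z i) ≤ 1 := by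
  classical
  have h1 : X ⊆ Fintype.piFinset fun i => X.image fun z => z i := fun z hz =>
    Fintype.mem_piFinset.2 fun i => Finset.mem_image_of_mem _ hz
  refine (Finset.sum_le_sum_of_subset_of_nonneg h1 fun z _ _ =>
    Finset.prod_nonneg fun i _ => (latticePrior_pos hS _).le).trans ?_
  rw [← Finset.prod_univ_sum (fun i => X.image fun z => z i) fun _ z => latticePrior S z]
  refine Finset.prod_le_one (fun i _ => Finset.sum_nonneg fun z _ => (latticePrior_pos hS z).le)
    fun i _ => ?_
  unfold latticePrior
  rw [← Finset.sum_div, div_le_one (by positivity)]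
  exact sum_exp_neg_abs_le hS _

theorem neg_log_latticePrior {S : ℝ} (hS : 0 < S) (z : ℤ) :
    -Real.log (latticePrior S z) = |(z : ℝ)| / S + Real.log (2 * (S + 1)) := by
  unfold latticePrior
  rw [Real.log_div (by positivity) (by positivity), Real.log_exp]
  ring

/-- The real and the imaginary part of a complex number. -/
def realPart (c : ℂ) (b : Bool) : ℝ := if b then c.re else c.im

/-- Coordinatewise floor of a block of transmitted vectors. -/
def quantize {L n : ℕ} (x : Fin n → EuclideanSpace ℂ (Fin L)) : Fin n × Fin L × Bool → ℤ :=
  fun i => ⌊realPart (x i.1 i.2.1) i.2.2⌋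

/-- The block of vectors with Gaussian-integer entries described by `z`. -/
def latticePoint {L n : ℕ} (z : Fin n × Fin L × Bool → ℤ) (t : Fin n) :
    EuclideanSpace ℂ (Fin L) :=
  WithLp.toLp 2 fun l => (z (t, l, true) : ℂ) + (z (t, l, false) : ℂ) * Complex.I

theorem norm_sub_latticePoint_sq_le {L n : ℕ} (x : Fin n → EuclideanSpace ℂ (Fin L)) (t : Fin n) :
    ‖x t - latticePoint (quantize x) t‖ ^ 2 ≤ 2 * L := by
  rw [EuclideanSpace.norm_sq_eq]
  have : ∀ l : Fin L, ‖(x t - latticePoint (quantize x) t) l‖ ^ 2 ≤ 2 := by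
    intro l
    rw [Complex.sq_norm, Complex.normSq_apply]
    simp only [latticePoint, quantize, realPart, PiLp.sub_apply, Complex.sub_re, Complex.sub_im,
      Complex.add_re, Complex.add_im, Complex.mul_re, Complex.mul_im, Complex.intCast_re,
      Complex.intCast_im, Complex.I_re, Complex.I_im]
    simp only [if_true, Bool.false_eq_true, if_false, mul_zero, mul_one, sub_zero,
      add_zero, zero_add]
    nlinarith [Int.floor_le (x t l).re, Int.lt_floor_add_one (x t l).re,
      Int.floor_le (x t l).im, Int.lt_floor_add_one (x t l).im]
  calc _ ≤ ∑ _l : Fin L, (2 : ℝ) := Finset.sum_le_sum fun l _ => this l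
    _ = _ := by simp [mul_comm]

/-- The price of describing the quantized codeword. Each real coordinate costs about `log √P`, and
each antenna has two, whence `L log P` per channel use. The term in `‖x t‖ ^ 2 / P` is bounded on
average by the power constraint. -/
theorem neg_log_prior_quantize_le {L n : ℕ} {P : ℝ} (hP : 1 ≤ P)
    (x : Fin n → EuclideanSpace ℂ (Fin L)) :
    -Real.log (∏ i, latticePrior (Real.sqrt P) (quantize x i)) ≤
      ∑ t, (‖x t‖ ^ 2 / (2 * P) + L * (Real.log P + 6)) := by
  set S := Real.sqrt P with hS
  have hS1 : 1 ≤ S := by rw [hS]; exact Real.one_le_sqrt.2 hP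
  have hS0 : 0 < S := by linarith
  have hS2 : S ^ 2 = P := Real.sq_sqrt (by linarith)
  have hlog : Real.log (2 * (S + 1)) ≤ Real.log P / 2 + 3 / 2 := by
    have h1 : Real.log (2 * (S + 1)) ≤ Real.log (4 * S) :=
      Real.log_le_log (by positivity) (by linarith)
    have h2 : Real.log (4 * S) = Real.log 4 + Real.log P / 2 := by
      rw [Real.log_mul (by norm_num) hS0.ne', hS, Real.log_sqrt (by linarith)]
    have h3 : Real.log 4 ≤ 3 / 2 := by
      have : Real.log 4 = 2 * Real.log 2 := by
        rw [show (4 : ℝ) = 2 ^ 2 by norm_num, Real.log_pow]; norm_num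
      linarith [Real.log_two_lt_d9]
    linarith
  rw [Real.log_prod (fun i _ => (latticePrior_pos hS0 _).ne'), ← Finset.sum_neg_distrib]
  simp_rw [neg_log_latticePrior hS0]
  rw [Fintype.sum_prod_type]
  refine Finset.sum_le_sum fun t _ => ?_
  rw [EuclideanSpace.norm_sq_eq, Finset.sum_div, Fintype.sum_prod_type]
  have h2 : (L : ℝ) * (Real.log P + 6) = ∑ _l : Fin L, (Real.log P + 6) := by
    rw [Finset.sum_const, Finset.card_univ, Fintype.card_fin, nsmul_eq_mul]
  rw [h2, ← Finset.sum_add_distrib]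
  refine Finset.sum_le_sum fun l _ => ?_
  have hfl : ∀ r : ℝ, |((⌊r⌋ : ℤ) : ℝ)| / S ≤ r ^ 2 / (2 * P) + 3 / 2 := by
    intro r
    have h3 : |((⌊r⌋ : ℤ) : ℝ)| ≤ |r| + 1 := by
      rw [abs_le]
      constructor
      · linarith [Int.lt_floor_add_one r, neg_abs_le r]
      · linarith [Int.floor_le r, le_abs_self r]
    rw [div_le_iff₀ hS0]
    have h4 : (r ^ 2 / (2 * P) + 3 / 2) * S = |r| ^ 2 / (2 * S) + 3 / 2 * S := by
      rw [← hS2, sq_abs]; field_simp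
    -- The arithmetic-geometric mean inequality trades the exponential tail of the prior for the
    -- second moment, which is what the power constraint controls.
    have h5 : |r| ≤ |r| ^ 2 / (2 * S) + S / 2 := by
      have : |r| ^ 2 / (2 * S) + S / 2 - |r| = (|r| - S) ^ 2 / (2 * S) := by field_simp; ring
      have h6 : 0 ≤ (|r| - S) ^ 2 / (2 * S) := by positivity
      linarith
    rw [h4]; linarith
  have ha := hfl (x t l).re
  have hb := hfl (x t l).im
  rw [Complex.sq_norm, Complex.normSq_apply]
  simp only [Fintype.sum_bool, quantize, realPart, if_true, Bool.false_eq_true, if_false]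
  have : ((x t l).re * (x t l).re + (x t l).im * (x t l).im) / (2 * P) =
    (x t l).re ^ 2 / (2 * P) + (x t l).im ^ 2 / (2 * P) := by ring
  rw [this]
  linarith

end Prior

/-! ### Converse for one demand and one decoding order -/

section Converse

variable {K₁ K₂ N L B n : ℕ} {γ₁ : ℝ}

/-- The requested bits that are cached neither by the user requesting them, nor by the users that
come before it in the decoding order `rank`. -/
def freshBits (cache : User K₁ K₂ → Finset (Fin N × Fin B)) (d : Demand K₁ K₂ N)
    (rank : User K₁ K₂ → ℕ) : Finset (Fin N × Fin B) :=
  open Classical in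
  Finset.univ.filter fun p => ∃ k, p.1 = d k ∧ ∀ j, rank j ≤ rank k → p ∉ cache j

/-- All users decode the library `W` from the received signals `y`. -/
def UncodedScheme.Decodes (S : UncodedScheme K₁ K₂ N L B n γ₁) (d : Demand K₁ K₂ N)
    (W : Library N B) (y : User K₁ K₂ → Fin n → ℂ) : Prop :=
  ∀ k, S.decode d k (y k) (fun p => W p.1.1 p.1.2) = W (d k)

-- Two libraries decoded from the same `y` that agree off the fresh bits are equal, by induction
-- along `rank`: a fresh bit in the cache of a user belongs to a file requested strictly earlier,
-- hence already known to agree. So at most one library is decoded per assignment of the non-fresh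
-- bits.
open Classical in
theorem UncodedScheme.card_decodes_mul_le (S : UncodedScheme K₁ K₂ N L B n γ₁)
    (d : Demand K₁ K₂ N) (rank : User K₁ K₂ → ℕ) (y : User K₁ K₂ → Fin n → ℂ) :
    (Finset.univ.filter fun W : Library N B => S.Decodes d W y).card *
      2 ^ (freshBits S.cache d rank).card ≤ Fintype.card (Library N B) := by
  set I := freshBits S.cache d rank with hI
  have hinj : Set.InjOn (fun (W : Library N B) (p : {p // p ∉ I}) => W p.1.1 p.1.2)
      (Finset.univ.filter fun W : Library N B => S.Decodes d W y) := by
    intro W hW W' hW' hagree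
    simp only [Finset.coe_filter, Finset.mem_univ, true_and, Set.mem_ofPred_eq] at hW hW'
    have hag : ∀ p : Fin N × Fin B, p ∉ I → W p.1 p.2 = W' p.1 p.2 := fun p hp =>
      congrFun hagree ⟨p, hp⟩
    have hfile : ∀ r k, rank k = r → W (d k) = W' (d k) := by
      intro r
      induction r using Nat.strong_induction_on with
      | _ r ih =>
        intro k hk
        have hcache : (fun p : S.cache k => W p.1.1 p.1.2) = fun p => W' p.1.1 p.1.2 := by
          funext p
          by_cases hp : p.1 ∈ I
          · rw [hI, freshBits, Finset.mem_filter] at hp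
            obtain ⟨-, k', hk', hj⟩ := hp
            have hlt : rank k' < r := by
              by_contra hcon
              exact hj k (by omega) p.2
            rw [hk', ih _ hlt k' rfl]
          · exact hag _ hp
        rw [← hW k, ← hW' k, hcache]
    funext f b
    by_cases hp : (f, b) ∈ I
    · rw [hI, freshBits, Finset.mem_filter] at hp
      obtain ⟨-, k, hk, -⟩ := hp
      simp only at hk
      rw [hk, hfile _ k rfl]
    · exact hag _ hp
  have hcard : (Finset.univ.filter fun W : Library N B => S.Decodes d W y).card ≤
      Fintype.card ({p // p ∉ I} → Bool) := by
    rw [← Finset.card_univ]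
    exact Finset.card_le_card_of_injOn _ (fun _ _ => Finset.mem_univ _) hinj
  have h1 : Fintype.card {p // p ∉ I} + I.card = N * B := by
    rw [Fintype.card_subtype_compl, Fintype.card_coe]
    have := I.card_le_univ
    simp only [Fintype.card_prod, Fintype.card_fin] at this ⊢
    omega
  calc _ ≤ Fintype.card ({p // p ∉ I} → Bool) * 2 ^ I.card := Nat.mul_le_mul_right _ hcard
    _ = 2 ^ (N * B) := by rw [Fintype.card_fun, Fintype.card_bool, ← pow_add, h1]
    _ = _ := by simp [Library, ← pow_mul, mul_comm]

theorem UncodedScheme.measurableSet_decodes (S : UncodedScheme K₁ K₂ N L B n γ₁)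
    (d : Demand K₁ K₂ N) (W : Library N B) : MeasurableSet {y | S.Decodes d W y} := by
  have : {y | S.Decodes d W y} = ⋂ k, (fun y : User K₁ K₂ → Fin n → ℂ =>
      S.decode d k (y k) fun p => W p.1.1 p.1.2) ⁻¹' {W (d k)} := by
    ext y; simp [UncodedScheme.Decodes]
  rw [this]
  exact MeasurableSet.iInter fun k =>
    ((S.measurable_decode d k _).comp (measurable_pi_apply k)) (measurableSet_singleton _)

/-- A Fano-type bound without entropies: for each `W` the variational inequality compares the true
received law with the law centred at the lattice point of its codeword, and the sum over `W` is
controlled by `card_decodes_mul_le` and the prior. The final `2 * η` is one `η` from failed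
decodings in `φ` and one from the error probability. -/
theorem UncodedScheme.card_freshBits_le (S : UncodedScheme K₁ K₂ N L B n γ₁)
    {h : User K₁ K₂ → EuclideanSpace ℂ (Fin L)} {P η : ℝ} (hP : 1 ≤ P) (hη : 0 < η)
    (hpow : S.PowerLE P) (d : Demand K₁ K₂ N) (herr : S.errorProb h d ≤ η ^ 2)
    (rank : User K₁ K₂ → ℕ) :
    (1 - η ^ 2) * ((freshBits S.cache d rank).card * Real.log 2) ≤
      n * (L * Real.log P + (1 + 6 * L + 2 * L * ∑ k, ‖h k‖ ^ 2)) + 2 * η := by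
  classical
  set M := (freshBits S.cache d rank).card with hM
  set ν := noise K₁ K₂ n with hν
  have hS0 : 0 < Real.sqrt P := Real.sqrt_pos.2 (by linarith)
  set G : (Fin n × Fin L × Bool → ℤ) → ℝ := fun z => ∏ i, latticePrior (Real.sqrt P) (z i) with hG
  have hGpos : ∀ z, 0 < G z := fun z => Finset.prod_pos fun i _ => latticePrior_pos hS0 _
  let sig : (Fin n → EuclideanSpace ℂ (Fin L)) → User K₁ K₂ → Fin n → ℂ :=
    fun x k t => inner ℂ (h k) (x t)
  let z : Library N B → Fin n × Fin L × Bool → ℤ := fun W => quantize (S.encode d W)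
  -- On success `exp φ = 2 ^ M` matches the count of decodable libraries. On failure the value `log
  -- η` keeps `φ` bounded and adds only `η` to each exponential.
  let φ : Library N B → (User K₁ K₂ → Fin n → ℂ) → ℝ := fun W y =>
    if S.Decodes d W y then M * Real.log 2 else Real.log η
  have hφm : ∀ W, Measurable (φ W) := fun W =>
    Measurable.ite (S.measurableSet_decodes d W) measurable_const measurable_const
  have hφb : ∀ W y, |φ W y| ≤ |M * Real.log 2| + |Real.log η| := by
    intro W y
    simp only [φ]
    split_ifs
    · linarith [abs_nonneg (Real.log η)]
    · linarith [abs_nonneg (M * Real.log 2)]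
  set e : Library N B → ℝ := fun W => ν.real {w | ¬ S.Succeeds h d W w} with he
  have hsucc : ∀ W w, S.Succeeds h d W w ↔ S.Decodes d W (sig (S.encode d W) + w) :=
    fun W w => Iff.rfl
  have hint : ∀ W, ∫ w, φ W (sig (S.encode d W) + w) ∂ν =
      M * Real.log 2 - e W * (M * Real.log 2 - Real.log η) := by
    intro W
    have hms : MeasurableSet {w | ¬ S.Succeeds h d W w} := by
      have : Measurable fun w : User K₁ K₂ → Fin n → ℂ => sig (S.encode d W) + w := by fun_prop
      exact (this (S.measurableSet_decodes d W)).compl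
    have : (fun w => φ W (sig (S.encode d W) + w)) = fun w => M * Real.log 2 +
        ({w | ¬ S.Succeeds h d W w}).indicator (fun _ => Real.log η - M * Real.log 2) w := by
      funext w
      simp only [φ, ← hsucc, Set.indicator_apply, Set.mem_ofPred_eq]
      by_cases hw : S.Succeeds h d W w <;> simp [hw]
    rw [this, integral_add (integrable_const _) ((integrable_const _).indicator hms),
      integral_indicator_const _ hms]
    simp only [integral_const, probReal_univ, smul_eq_mul, one_mul]
    rw [he]; ring
  have hκ : ∀ W, ∑ k, ∑ t, ‖(sig (S.encode d W) - sig (latticePoint (z W))) k t‖ ^ 2 ≤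
      n * (2 * L * ∑ k, ‖h k‖ ^ 2) := by
    intro W
    have : ∀ k t, ‖(sig (S.encode d W) - sig (latticePoint (z W))) k t‖ ^ 2 ≤
        ‖h k‖ ^ 2 * (2 * L) := by
      intro k t
      have h1 : (sig (S.encode d W) - sig (latticePoint (z W))) k t =
          inner ℂ (h k) (S.encode d W t - latticePoint (z W) t) := by
        simp [sig]
      rw [h1]
      calc _ ≤ (‖h k‖ * ‖S.encode d W t - latticePoint (z W) t‖) ^ 2 :=
            pow_le_pow_left₀ (norm_nonneg _) (norm_inner_le_norm _ _) 2
        _ = ‖h k‖ ^ 2 * ‖S.encode d W t - latticePoint (z W) t‖ ^ 2 := by ring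
        _ ≤ _ := by gcongr; exact norm_sub_latticePoint_sq_le _ t
    calc _ ≤ ∑ k, ∑ _t : Fin n, ‖h k‖ ^ 2 * (2 * L) :=
          Finset.sum_le_sum fun k _ => Finset.sum_le_sum fun t _ => this k t
      _ = _ := by
        simp only [Finset.sum_const, Finset.card_univ, Fintype.card_fin, nsmul_eq_mul]
        rw [← Finset.mul_sum, ← Finset.sum_mul]; ring
  have hstep : ∀ W, M * Real.log 2 - e W * (M * Real.log 2 - Real.log η) -
      n * (2 * L * ∑ k, ‖h k‖ ^ 2) -
      ∑ t, (‖S.encode d W t‖ ^ 2 / (2 * P) + L * (Real.log P + 6)) ≤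
      G (z W) * ∫ w, Real.exp (φ W (sig (latticePoint (z W)) + w)) ∂ν - 1 := by
    intro W
    have h1 := (hasShiftEntropy_noise (sig (S.encode d W) - sig (latticePoint (z W)))).integral_le
      (f := fun w => φ W (sig (S.encode d W) + w)) ((hφm W).comp (by fun_prop))
      (fun w => hφb W _) (hGpos (z W))
    rw [← hν, hint] at h1
    have h2 : ∀ w, sig (S.encode d W) + (w - (sig (S.encode d W) - sig (latticePoint (z W)))) =
        sig (latticePoint (z W)) + w := fun w => by abel
    simp only [h2] at h1
    have h3 := neg_log_prior_quantize_le hP (S.encode d W)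
    have h4 := hκ W
    simp only [hG, z] at h1 h4 ⊢
    linarith
  have hexpint : ∀ W y, Integrable (fun w => Real.exp (φ W (y + w))) ν := by
    intro W y
    refine Integrable.of_bound ?_ (Real.exp (|M * Real.log 2| + |Real.log η|))
      (Eventually.of_forall fun w => ?_)
    · have : Measurable fun w => φ W (y + w) := (hφm W).comp (by fun_prop)
      exact (Real.measurable_exp.comp this).aestronglyMeasurable
    · rw [Real.norm_eq_abs, abs_of_pos (Real.exp_pos _)]
      exact Real.exp_le_exp.2 ((le_abs_self _).trans (hφb W _))
  set c : ℝ := (Fintype.card (Library N B) : ℝ) with hc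
  have hc0 : 0 < c := by rw [hc]; exact_mod_cast Fintype.card_pos
  have hpoint : ∀ y, ∑ W, Real.exp (φ W y) ≤ c * (1 + η) := by
    intro y
    have h1 : ∀ W, Real.exp (φ W y) ≤ (if S.Decodes d W y then (2 : ℝ) ^ M else 0) + η := by
      intro W
      simp only [φ]
      split_ifs
      · rw [← Real.log_pow, Real.exp_log (by positivity)]; linarith
      · rw [Real.exp_log hη]; linarith
    calc _ ≤ ∑ W, ((if S.Decodes d W y then (2 : ℝ) ^ M else 0) + η) :=
          Finset.sum_le_sum fun W _ => h1 W
      _ = ((Finset.univ.filter fun W => S.Decodes d W y).card * 2 ^ M : ℕ) + c * η := by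
          rw [Finset.sum_add_distrib, ← Finset.sum_filter]
          simp [hc]
      _ ≤ c + c * η := by
          gcongr
          rw [hc]
          exact_mod_cast S.card_decodes_mul_le d rank y
      _ = _ := by ring
  have hmix : ∑ W, G (z W) * ∫ w, Real.exp (φ W (sig (latticePoint (z W)) + w)) ∂ν ≤
      c * (1 + η) := by
    -- The lattice point depends on `W`. Bounding its term by the sum over all occurring points
    -- makes the point independent of `W`, so that `hpoint` applies for each of them.
    set X : Finset (Fin n × Fin L × Bool → ℤ) := Finset.univ.image z with hX
    calc _ ≤ ∑ W, ∑ u ∈ X, G u * ∫ w, Real.exp (φ W (sig (latticePoint u) + w)) ∂ν := by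
          refine Finset.sum_le_sum fun W _ => ?_
          exact Finset.single_le_sum (f := fun u => G u * ∫ w, Real.exp
            (φ W (sig (latticePoint u) + w)) ∂ν)
            (fun u _ => mul_nonneg (hGpos u).le (integral_nonneg fun w => (Real.exp_pos _).le))
            (Finset.mem_image_of_mem z (Finset.mem_univ W))
      _ = ∑ u ∈ X, G u * ∫ w, ∑ W, Real.exp (φ W (sig (latticePoint u) + w)) ∂ν := by
          rw [Finset.sum_comm]
          refine Finset.sum_congr rfl fun u _ => ?_
          rw [integral_finsetSum _ fun W _ => hexpint W _, Finset.mul_sum]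
      _ ≤ ∑ u ∈ X, G u * (c * (1 + η)) := by
          refine Finset.sum_le_sum fun u _ => mul_le_mul_of_nonneg_left ?_ (hGpos u).le
          calc _ ≤ ∫ _w, c * (1 + η) ∂ν :=
                integral_mono (integrable_finsetSum _ fun W _ => hexpint W _)
                  (integrable_const _) fun w => hpoint _
            _ = _ := by simp
      _ ≤ 1 * (c * (1 + η)) := by
          rw [← Finset.sum_mul]
          exact mul_le_mul_of_nonneg_right (sum_prod_latticePrior_le_one hS0 X) (by positivity)
      _ = _ := one_mul _
  have hsum := Finset.sum_le_sum fun (W : Library N B) (_ : W ∈ Finset.univ) => hstep W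
  simp only [Finset.sum_sub_distrib, ← Finset.sum_mul, Finset.sum_const, Finset.card_univ,
    nsmul_eq_mul, mul_one, ← hc] at hsum
  have herr' : ∑ W, e W ≤ η ^ 2 * c := by
    rwa [UncodedScheme.errorProb, div_le_iff₀ hc0] at herr
  have hpow' : ∑ W, ∑ t, (‖S.encode d W t‖ ^ 2 / (2 * P) + L * (Real.log P + 6)) ≤
      c * (n * (1 + L * (Real.log P + 6))) := by
    rw [Finset.sum_comm]
    have : ∀ t, ∑ W, (‖S.encode d W t‖ ^ 2 / (2 * P) + L * (Real.log P + 6)) ≤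
        c * (1 + L * (Real.log P + 6)) := by
      intro t
      have h1 := hpow d t
      rw [div_le_iff₀ hc0] at h1
      rw [Finset.sum_add_distrib, ← Finset.sum_div, Finset.sum_const, Finset.card_univ,
        nsmul_eq_mul, ← hc]
      have h2 : (∑ W, ‖S.encode d W t‖ ^ 2) / (2 * P) ≤ c := by
        rw [div_le_iff₀ (by linarith)]
        nlinarith
      linarith
    calc _ ≤ ∑ _t : Fin n, c * (1 + L * (Real.log P + 6)) := Finset.sum_le_sum fun t _ => this t
      _ = _ := by simp; ring
  -- The error probability is at most `η ^ 2`, so the penalty `-log η` for failures contributes at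
  -- most `η ^ 2 / η = η`.
  have hlogη : -Real.log η ≤ 1 / η := by
    rw [← Real.log_inv, ← one_div]
    exact (Real.log_le_sub_one_of_pos (by positivity)).trans (by linarith)
  have hq : 0 ≤ M * Real.log 2 + 1 / η := by
    have := Real.log_nonneg (show (1 : ℝ) ≤ 2 by norm_num)
    positivity
  have he0 : 0 ≤ ∑ W, e W := Finset.sum_nonneg fun W _ => measureReal_nonneg
  have h5 : (∑ W, e W) * (M * Real.log 2 - Real.log η) ≤ η ^ 2 * c * (M * Real.log 2 + 1 / η) :=
    (mul_le_mul_of_nonneg_left (by linarith) he0).trans (mul_le_mul_of_nonneg_right herr' hq)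
  have h6 : η ^ 2 * c * (M * Real.log 2 + 1 / η) = c * (η ^ 2 * (M * Real.log 2) + η) := by
    field_simp
  have h7 : c * ((1 - η ^ 2) * (M * Real.log 2)) ≤
      c * (n * (L * Real.log P + (1 + 6 * L + 2 * L * ∑ k, ‖h k‖ ^ 2)) + 2 * η) := by
    nlinarith
  exact le_of_mul_le_mul_left h7 hc0

end Converse

/-! ### Averaging over demands and decoding orders -/

section Averaging

/-- By symmetry under transpositions, each element of `U` is the first one of `U` in the same number
of orders. -/
theorem card_perm_min_mul_card {K : ℕ} (U : Finset (Fin K)) {k : Fin K} (hk : k ∈ U) :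
    (Finset.univ.filter fun σ : Equiv.Perm (Fin K) => ∀ j ∈ U, σ k ≤ σ j).card * U.card =
      Fintype.card (Equiv.Perm (Fin K)) := by
  have hsym : ∀ k' ∈ U, (Finset.univ.filter fun σ : Equiv.Perm (Fin K) =>
      ∀ j ∈ U, σ k' ≤ σ j).card =
      (Finset.univ.filter fun σ : Equiv.Perm (Fin K) => ∀ j ∈ U, σ k ≤ σ j).card := by
    intro k' hk'
    have hswap : ∀ j ∈ U, Equiv.swap k k' j ∈ U := by
      intro j hj
      rw [Equiv.swap_apply_def]
      split_ifs <;> assumption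
    refine Finset.card_bijective (fun σ => σ * Equiv.swap k k')
      (Group.mulRight_bijective _) fun σ => ?_
    simp only [Finset.mem_filter, Finset.mem_univ, true_and, Equiv.Perm.coe_mul,
      Function.comp_apply, Equiv.swap_apply_left]
    constructor
    · exact fun h j hj => h _ (hswap j hj)
    · intro h j hj
      simpa using h _ (hswap j hj)
  have hpart : ∑ k' ∈ U, (Finset.univ.filter fun σ : Equiv.Perm (Fin K) =>
      ∀ j ∈ U, σ k' ≤ σ j).card = Fintype.card (Equiv.Perm (Fin K)) := by
    rw [← Finset.card_biUnion]
    · rw [← Finset.card_univ]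
      congr 1
      ext σ
      simp only [Finset.mem_biUnion, Finset.mem_filter, Finset.mem_univ, true_and, iff_true]
      exact Finset.exists_min_image U σ ⟨k, hk⟩
    · intro a ha b hb hab
      rw [Function.onFun, Finset.disjoint_left]
      intro σ h1 h2
      simp only [Finset.mem_filter, Finset.mem_univ, true_and] at h1 h2
      exact hab (σ.injective (le_antisymm (h1 b hb) (h2 a ha)))
  rw [Finset.sum_congr rfl hsym, Finset.sum_const, smul_eq_mul, mul_comm] at hpart
  exact hpart

/-- A user `k` outside `s` precedes all of `s` exactly when it comes first in `insert k s`, which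
has probability `1 / (s.card + 1)`; there are `K - s.card` such users, and the members of `s`
contribute nothing. -/
theorem sum_card_perm_before {K : ℕ} (s : Finset (Fin K)) :
    (∑ k, ((Finset.univ.filter fun σ : Equiv.Perm (Fin K) => ∀ j ∈ s, σ k < σ j).card : ℝ)) =
      Fintype.card (Equiv.Perm (Fin K)) * ((K - s.card) / (s.card + 1)) := by
  have h1 : ∀ k ∈ s, ((Finset.univ.filter fun σ : Equiv.Perm (Fin K) =>
      ∀ j ∈ s, σ k < σ j).card : ℝ) = 0 := by
    intro k hk
    rw [Nat.cast_eq_zero, Finset.card_eq_zero, Finset.filter_eq_empty_iff]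
    exact fun σ _ h => lt_irrefl _ (h k hk)
  have h2 : ∀ k ∈ sᶜ, ((Finset.univ.filter fun σ : Equiv.Perm (Fin K) =>
      ∀ j ∈ s, σ k < σ j).card : ℝ) = Fintype.card (Equiv.Perm (Fin K)) / (s.card + 1) := by
    intro k hk
    rw [Finset.mem_compl] at hk
    have := card_perm_min_mul_card (insert k s) (Finset.mem_insert_self k s)
    rw [Finset.card_insert_of_notMem hk] at this
    rw [eq_div_iff (by positivity), ← this]
    push_cast
    congr 3
    ext σ
    simp only [Finset.mem_filter, Finset.mem_univ, true_and, Finset.mem_insert, forall_eq_or_imp,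
      le_refl]
    refine forall₂_congr fun j hj => ?_
    have : σ k ≠ σ j := fun h => hk (σ.injective h ▸ hj)
    exact ⟨le_of_lt, fun h => lt_of_le_of_ne h this⟩
  rw [← Finset.sum_add_sum_compl s, Finset.sum_eq_zero h1, Finset.sum_congr rfl h2,
    Finset.sum_const, Finset.card_compl, Fintype.card_fin, nsmul_eq_mul,
    Nat.cast_sub (by simpa using s.card_le_univ)]
  ring

/-- The tangent to the convex function `s ↦ (K - s) / (s + 1)` at `s = K γ`, where its value is
`singleDelay K γ`; the gap is an explicit multiple of `(s - K γ) ^ 2`. -/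
theorem singleDelay_tangent_le {K : ℕ} {γ : ℝ} (hγ : 0 ≤ γ) (s : ℕ) :
    singleDelay K γ - (K + 1) / (1 + K * γ) ^ 2 * (s - K * γ) ≤ ((K : ℝ) - s) / (s + 1) := by
  have h1 : 0 < 1 + K * γ := by positivity
  have h2 : (0 : ℝ) < s + 1 := by positivity
  have : ((K : ℝ) - s) / (s + 1) -
      (singleDelay K γ - (K + 1) / (1 + K * γ) ^ 2 * (s - K * γ)) =
      (K + 1) * (s - K * γ) ^ 2 / ((s + 1) * (1 + K * γ) ^ 2) := by
    unfold singleDelay; field_simp; ring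
  have h3 : 0 ≤ (K + 1) * (s - K * γ) ^ 2 / ((s + 1) * (1 + K * γ) ^ 2) := by positivity
  linarith

variable {K₁ K₂ N B : ℕ}

/-- First the cache-less users, then the cache-aided users in the order `σ`. -/
def orderRank (K₂ : ℕ) (σ : Equiv.Perm (Fin K₁)) : User K₁ K₂ → ℕ :=
  Sum.elim (fun k => K₂ + σ k) (fun g => g)

/-- The cache-aided users that store a given bit. -/
def holders (cache : User K₁ K₂ → Finset (Fin N × Fin B)) (p : Fin N × Fin B) :
    Finset (Fin K₁) :=
  open Classical in Finset.univ.filter fun k => p ∈ cache (Sum.inl k)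

-- All bits requested by cache-less users are fresh, since nobody with a cache comes before them.
-- The strict `σ k < σ j` also excludes the bits that `k` stores itself.
open Classical in
theorem le_card_freshBits (cache : User K₁ K₂ → Finset (Fin N × Fin B))
    (hcache : ∀ g, cache (Sum.inr g) = ∅) (d : Demand K₁ K₂ N) (σ : Equiv.Perm (Fin K₁)) :
    K₂ * B + ∑ k : Fin K₁, ∑ b : Fin B,
      (if ∀ j ∈ holders cache (d (Sum.inl k), b), σ k < σ j then 1 else 0) ≤
      (freshBits cache d (orderRank K₂ σ)).card := by
  have h1 : (Finset.univ.filter fun q : User K₁ K₂ × Fin B => ∀ j,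
      orderRank K₂ σ j ≤ orderRank K₂ σ q.1 → (d q.1, q.2) ∉ cache j).card ≤
      (freshBits cache d (orderRank K₂ σ)).card := by
    refine Finset.card_le_card_of_injOn (fun q => (d q.1, q.2)) ?_ ?_
    · intro q hq
      simp only [Finset.coe_filter, Finset.mem_univ, true_and, Set.mem_ofPred_eq] at hq
      simp only [freshBits, Finset.coe_filter, Finset.mem_univ, true_and, Set.mem_ofPred_eq]
      exact ⟨q.1, rfl, hq⟩
    · rintro ⟨k, b⟩ - ⟨k', b'⟩ - h
      simpa using h
  refine le_trans (le_of_eq ?_) h1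
  rw [Finset.card_filter, Fintype.sum_prod_type, Fintype.sum_sum_type, add_comm]
  congr 1
  · refine Finset.sum_congr rfl fun k _ => Finset.sum_congr rfl fun b _ => ?_
    congr 1
    simp only [eq_iff_iff, holders, Finset.mem_filter, Finset.mem_univ, true_and]
    constructor
    · rintro h (j | g) hj
      · intro hmem
        have := h j hmem
        simp only [orderRank, Sum.elim_inl] at hj
        omega
      · simp [hcache]
    · intro h j hj
      by_contra hcon
      exact h (Sum.inl j) (by simp only [orderRank, Sum.elim_inl]; omega) hj
  · symm
    rw [Finset.sum_congr rfl fun g _ => Finset.sum_congr rfl fun b _ => if_pos ?_]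
    · simp
    · rintro (j | g') hj
      · simp only [orderRank, Sum.elim_inl, Sum.elim_inr] at hj
        omega
      · simp [hcache]

theorem exists_le_card_freshBits {γ : ℝ} (hγ : 0 ≤ γ) (hN : K₁ + K₂ ≤ N) (hN0 : 0 < N)
    (cache : User K₁ K₂ → Finset (Fin N × Fin B))
    (hcache : ∀ k, ((cache k).card : ℝ) ≤ cacheSize K₁ K₂ γ k * (N * B)) :
    ∃ (d : Demand K₁ K₂ N) (rank : User K₁ K₂ → ℕ),
      B * (K₂ + singleDelay K₁ γ) ≤ ((freshBits cache d rank).card : ℝ) := by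
  classical
  have : NeZero N := ⟨hN0.ne'⟩
  have hempty : ∀ g, cache (Sum.inr g) = ∅ := by
    intro g
    have := hcache (Sum.inr g)
    simp only [cacheSize, Sum.elim_inr, zero_mul] at this
    exact Finset.card_eq_zero.1 (by exact_mod_cast le_antisymm this (Nat.cast_nonneg _))
  obtain ⟨e⟩ : Nonempty (User K₁ K₂ ↪ Fin N) :=
    Function.Embedding.nonempty_of_card_le (by simpa using hN)
  -- Cyclic shifts of one demand suffice for the averaging: as `c` varies, each user requests every
  -- file exactly once.
  obtain ⟨d, hd⟩ : ∃ d : Fin N → Demand K₁ K₂ N, ∀ c k, d c k = e k + c :=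
    ⟨fun c => e.trans (Equiv.addRight c).toEmbedding, fun _ _ => rfl⟩
  set Q : ℝ := (Fintype.card (Equiv.Perm (Fin K₁)) : ℝ) with hQ
  have hQ0 : 0 < Q := by rw [hQ]; exact_mod_cast Fintype.card_pos
  have hholders : ∑ p, ((holders cache p).card : ℝ) ≤ K₁ * γ * (N * B) := by
    calc ∑ p, ((holders cache p).card : ℝ) =
          ∑ k : Fin K₁, ((cache (Sum.inl k)).card : ℝ) := by
          simp only [holders, Finset.card_filter, Nat.cast_sum]
          rw [Finset.sum_comm]
          refine Finset.sum_congr rfl fun k _ => ?_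
          rw [← Nat.cast_sum, ← Finset.card_filter]
          congr 2
          ext p; simp
      _ ≤ ∑ _k : Fin K₁, γ * (N * B) := Finset.sum_le_sum fun k _ => hcache (Sum.inl k)
      _ = _ := by simp; ring
  have hbits : N * B * singleDelay K₁ γ ≤
      ∑ p : Fin N × Fin B, ((K₁ : ℝ) - (holders cache p).card) / ((holders cache p).card + 1) := by
    calc (N * B * singleDelay K₁ γ : ℝ) ≤ ∑ p : Fin N × Fin B, (singleDelay K₁ γ -
          (K₁ + 1) / (1 + K₁ * γ) ^ 2 * ((holders cache p).card - K₁ * γ)) := by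
          rw [Finset.sum_sub_distrib, ← Finset.mul_sum, Finset.sum_sub_distrib]
          simp only [Finset.sum_const, Finset.card_univ, Fintype.card_prod, Fintype.card_fin,
            nsmul_eq_mul, Nat.cast_mul]
          have : 0 ≤ (K₁ + 1 : ℝ) / (1 + K₁ * γ) ^ 2 := by positivity
          nlinarith
      _ ≤ _ := Finset.sum_le_sum fun p _ => singleDelay_tangent_le hγ _
  have hcount : Q * (N * B * singleDelay K₁ γ) ≤ ∑ c : Fin N, ∑ σ : Equiv.Perm (Fin K₁),
      ∑ k : Fin K₁, ∑ b : Fin B,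
        (if ∀ j ∈ holders cache (d c (Sum.inl k), b), σ k < σ j then (1 : ℝ) else 0) := by
    calc Q * (N * B * singleDelay K₁ γ) ≤ Q * ∑ p : Fin N × Fin B,
          ((K₁ : ℝ) - (holders cache p).card) / ((holders cache p).card + 1) := by gcongr
      _ = ∑ p : Fin N × Fin B, ∑ k : Fin K₁, ∑ σ : Equiv.Perm (Fin K₁),
          (if ∀ j ∈ holders cache p, σ k < σ j then (1 : ℝ) else 0) := by
          rw [Finset.mul_sum]
          refine Finset.sum_congr rfl fun p _ => ?_
          rw [← sum_card_perm_before]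
          simp
      _ = ∑ σ : Equiv.Perm (Fin K₁), ∑ k : Fin K₁, ∑ b : Fin B, ∑ f : Fin N,
          (if ∀ j ∈ holders cache (f, b), σ k < σ j then (1 : ℝ) else 0) := by
          rw [Finset.sum_comm, Finset.sum_congr rfl fun k _ => Finset.sum_comm, Finset.sum_comm]
          exact Finset.sum_congr rfl fun σ _ => Finset.sum_congr rfl fun k _ =>
            Fintype.sum_prod_type_right _
      _ = ∑ σ : Equiv.Perm (Fin K₁), ∑ k : Fin K₁, ∑ b : Fin B, ∑ c : Fin N,
          (if ∀ j ∈ holders cache (d c (Sum.inl k), b), σ k < σ j then (1 : ℝ) else 0) := by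
          refine Finset.sum_congr rfl fun σ _ => Finset.sum_congr rfl fun k _ =>
            Finset.sum_congr rfl fun b _ => ?_
          simp only [hd]
          exact (Equiv.sum_comp (Equiv.addLeft (e (Sum.inl k))) fun f =>
            if ∀ j ∈ holders cache (f, b), σ k < σ j then (1 : ℝ) else 0).symm
      _ = _ := by
          symm
          rw [Finset.sum_comm]
          refine Finset.sum_congr rfl fun σ _ => ?_
          rw [Finset.sum_comm]
          refine Finset.sum_congr rfl fun k _ => ?_
          rw [Finset.sum_comm]
  have hle : ∑ _q : Fin N × Equiv.Perm (Fin K₁), (B * (K₂ + singleDelay K₁ γ) : ℝ) ≤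
      ∑ q : Fin N × Equiv.Perm (Fin K₁),
        ((freshBits cache (d q.1) (orderRank K₂ q.2)).card : ℝ) := by
    calc _ = ∑ _c : Fin N, ∑ _σ : Equiv.Perm (Fin K₁), (K₂ * B : ℝ) +
          Q * (N * B * singleDelay K₁ γ) := by
          simp only [Finset.sum_const, Finset.card_univ, Fintype.card_prod, Fintype.card_fin,
            nsmul_eq_mul, Nat.cast_mul, ← hQ]
          ring
      _ ≤ ∑ _c : Fin N, ∑ _σ : Equiv.Perm (Fin K₁), (K₂ * B : ℝ) +
          ∑ c : Fin N, ∑ σ : Equiv.Perm (Fin K₁), ∑ k : Fin K₁, ∑ b : Fin B,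
          (if ∀ j ∈ holders cache (d c (Sum.inl k), b), σ k < σ j then (1 : ℝ) else 0) :=
          add_le_add le_rfl hcount
      _ = ∑ c : Fin N, ∑ σ : Equiv.Perm (Fin K₁), ((K₂ * B : ℝ) + ∑ k : Fin K₁, ∑ b : Fin B,
        (if ∀ j ∈ holders cache (d c (Sum.inl k), b), σ k < σ j then (1 : ℝ) else 0)) := by
          simp only [Finset.sum_add_distrib]
      _ ≤ ∑ c : Fin N, ∑ σ : Equiv.Perm (Fin K₁),
          ((freshBits cache (d c) (orderRank K₂ σ)).card : ℝ) := by
          refine Finset.sum_le_sum fun c _ => Finset.sum_le_sum fun σ _ => ?_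
          have h1 := Nat.cast_le (α := ℝ).2 (le_card_freshBits cache hempty (d c) σ)
          push_cast at h1
          exact h1
      _ = _ := by rw [Fintype.sum_prod_type]
  obtain ⟨q, -, hq⟩ := Finset.exists_le_of_sum_le
    (Finset.univ_nonempty (α := Fin N × Equiv.Perm (Fin K₁))) hle
  exact ⟨_, _, hq⟩

end Averaging

/-- The converse: at high signal-to-noise ratio no delay below `(K₂ + T_{K₁}) / L` is
achievable with uncoded placement. -/
theorem eventually_le_of_achievableAt {K₁ K₂ N L : ℕ} {γ : ℝ} (hγ : 0 ≤ γ) (hγ1 : γ ≤ 1)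
    (hN : K₁ + K₂ ≤ N) (hN0 : 0 < N) (hL : 1 ≤ L)
    (h : User K₁ K₂ → EuclideanSpace ℂ (Fin L)) {δ : ℝ} (hδ : 0 < δ) :
    ∀ᶠ P : ℝ in atTop, ∀ Δ, AchievableAt N γ h P Δ →
      (K₂ + singleDelay K₁ γ) / L - δ ≤ Δ := by
  set D : ℝ := (K₂ + singleDelay K₁ γ) / L with hD
  set c : ℝ := 1 + 6 * L + 2 * L * ∑ k, ‖h k‖ ^ 2 with hc
  have hc0 : 0 < c := by
    have : 0 ≤ ∑ k, ‖h k‖ ^ 2 := Finset.sum_nonneg fun k _ => by positivity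
    positivity
  have hL0 : (0 : ℝ) < L := by exact_mod_cast hL
  have hT : 0 ≤ singleDelay K₁ γ := by
    unfold singleDelay
    have : 0 ≤ 1 - γ := by linarith
    positivity
  have hD0 : 0 ≤ D := by positivity
  filter_upwards [eventually_gt_atTop 1,
    Real.tendsto_log_atTop.eventually_ge_atTop (D * c / (L * δ))] with P hP1 hPδ Δ hΔ
  have hlogP : 0 < Real.log P := Real.log_pos hP1
  have hlog2 : 0 < Real.log 2 := Real.log_pos (by norm_num)
  rw [div_le_iff₀ (by positivity)] at hPδ
  by_contra hcon
  push Not at hcon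
  have hΔD : Δ ≤ D := by linarith
  have hkey : ∀ η : ℝ, 0 < η → η < 1 →
      (1 - η ^ 2) * (L * D * Real.log 2) ≤
        Δ * Real.log 2 * (L + c / Real.log P) + 2 * η := by
    intro η hη hη1
    -- The file size depends on `η`, but `B ≥ 1` allows dividing by it while the error term stays at
    -- most `2 * η`; then `η → 0` at fixed `P`.
    obtain ⟨B, n, S, hB, hpow, herr, hdel⟩ := hΔ (η ^ 2) (by positivity)
    obtain ⟨d, rank, hd⟩ := exists_le_card_freshBits hγ hN hN0 S.cache S.card_cache_le
    have h1 := S.card_freshBits_le hP1.le hη hpow d (herr d) rank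
    have hB0 : (1 : ℝ) ≤ B := by exact_mod_cast hB
    have hη2 : 0 ≤ 1 - η ^ 2 := by nlinarith
    have h2 : (1 - η ^ 2) * (B * (L * D) * Real.log 2) ≤
        (1 - η ^ 2) * ((freshBits S.cache d rank).card * Real.log 2) := by
      have : B * (L * D) = B * (K₂ + singleDelay K₁ γ) := by rw [hD]; field_simp
      rw [this]
      gcongr
    have h3 : (n : ℝ) * Real.log P ≤ Δ * Real.log 2 * B := by
      rw [div_le_iff₀ (by linarith), Real.logb, ← mul_div_assoc, div_le_iff₀ hlog2] at hdel
      linarith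
    have h4 : (n : ℝ) * (L * Real.log P + c) ≤ Δ * Real.log 2 * B * (L + c / Real.log P) := by
      have : (n : ℝ) * (L * Real.log P + c) = n * Real.log P * (L + c / Real.log P) := by
        field_simp
      rw [this]
      gcongr
    have h5 : B * ((1 - η ^ 2) * (L * D * Real.log 2)) ≤
        B * (Δ * Real.log 2 * (L + c / Real.log P) + 2 * η) := by nlinarith
    exact le_of_mul_le_mul_left h5 (by linarith)
  have hlim : L * D * Real.log 2 ≤ Δ * Real.log 2 * (L + c / Real.log P) := by
    have t1 : Tendsto (fun η : ℝ => (1 - η ^ 2) * (L * D * Real.log 2)) (nhdsWithin 0 (Set.Ioi 0))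
        (nhds ((1 - 0 ^ 2) * (L * D * Real.log 2))) :=
      (Continuous.tendsto (by fun_prop) 0).mono_left nhdsWithin_le_nhds
    have t2 : Tendsto (fun η : ℝ => Δ * Real.log 2 * (L + c / Real.log P) + 2 * η)
        (nhdsWithin 0 (Set.Ioi 0)) (nhds (Δ * Real.log 2 * (L + c / Real.log P) + 2 * 0)) :=
      (Continuous.tendsto (by fun_prop) 0).mono_left nhdsWithin_le_nhds
    have h1 := le_of_tendsto_of_tendsto t1 t2 (by
      filter_upwards [Ioo_mem_nhdsGT (show (0 : ℝ) < 1 by norm_num)] with η hη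
      exact hkey η hη.1 hη.2)
    simpa using h1
  have hlim' : L * D ≤ Δ * (L + c / Real.log P) := by
    refine le_of_mul_le_mul_right ?_ hlog2
    linarith
  have h6 : L * (D - Δ) ≤ D * c / Real.log P := by
    have : Δ * (c / Real.log P) ≤ D * (c / Real.log P) := by gcongr
    have h7 : D * c / Real.log P = D * (c / Real.log P) := by ring
    rw [h7]; nlinarith
  have h8 : D * c / Real.log P ≤ L * δ := by
    rw [div_le_iff₀ hlogP]; linarith
  have : D - Δ ≤ δ := le_of_mul_le_mul_left (h6.trans h8) hL0
  linarith

/-! ### Codes for the Gaussian channel at high signal-to-noise ratio -/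

section Coding

/-- A word of the ball is given by the set of disagreeing positions, one of at most `2 ^ m`, and the
symbols there. -/
theorem card_hammingBall_le {A : Type*} [Fintype A] [DecidableEq A] [Nonempty A] {m : ℕ}
    (d : ℕ) (x : Fin m → A) :
    (Finset.univ.filter fun y => hammingDist x y < d).card ≤ 2 ^ m * Fintype.card A ^ d := by
  have hsub : (Finset.univ.filter fun y => hammingDist x y < d) ⊆
      ((Finset.univ : Finset (Finset (Fin m))).filter fun T => T.card < d).biUnion fun T =>
        Fintype.piFinset fun i => if i ∈ T then Finset.univ else {x i} := by
    intro y hy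
    simp only [Finset.mem_filter, Finset.mem_univ, true_and] at hy
    simp only [Finset.mem_biUnion, Finset.mem_filter, Finset.mem_univ, true_and,
      Fintype.mem_piFinset]
    refine ⟨Finset.univ.filter fun i => x i ≠ y i, hy, fun i => ?_⟩
    by_cases h : x i = y i <;> simp [h]
  refine (Finset.card_le_card hsub).trans (Finset.card_biUnion_le.trans ?_)
  have hq : 1 ≤ Fintype.card A := Fintype.card_pos
  calc _ ≤ ∑ _T ∈ (Finset.univ : Finset (Finset (Fin m))).filter fun T => T.card < d,
        Fintype.card A ^ d := by
        refine Finset.sum_le_sum fun T hT => ?_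
        simp only [Finset.mem_filter, Finset.mem_univ, true_and] at hT
        rw [Fintype.card_piFinset]
        have : ∀ i, (if i ∈ T then Finset.univ else {x i} : Finset A).card =
            if i ∈ T then Fintype.card A else 1 := by
          intro i; split_ifs <;> simp
        simp only [this, Finset.prod_ite_mem, Finset.univ_inter, Finset.prod_const]
        exact Nat.pow_le_pow_right hq hT.le
    _ ≤ _ := by
        rw [Finset.sum_const, smul_eq_mul]
        refine Nat.mul_le_mul_right _ ((Finset.card_filter_le _ _).trans ?_)
        simp

/-- The Gilbert–Varshamov bound. -/
theorem exists_hammingCode (A : Type*) [Fintype A] [DecidableEq A] [Nonempty A] (m : ℕ) {d : ℕ}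
    (hd : 0 < d) : ∃ C : Finset (Fin m → A),
      (∀ x ∈ C, ∀ y ∈ C, hammingDist x y < d → x = y) ∧
      Fintype.card A ^ m ≤ C.card * (2 ^ m * Fintype.card A ^ d) := by
  classical
  obtain ⟨C, hC, hmax⟩ := Finset.exists_max_image
    ((Finset.univ : Finset (Finset (Fin m → A))).filter fun C =>
      ∀ x ∈ C, ∀ y ∈ C, hammingDist x y < d → x = y) Finset.card ⟨∅, by simp⟩
  simp only [Finset.mem_filter, Finset.mem_univ, true_and] at hC hmax
  refine ⟨C, hC, ?_⟩
  -- A word outside all balls around a code of maximal size could be added to it.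
  have hcover : (Finset.univ : Finset (Fin m → A)) ⊆
      C.biUnion fun x => Finset.univ.filter fun y => hammingDist x y < d := by
    intro y _
    by_contra hy
    simp only [Finset.mem_biUnion, Finset.mem_filter, Finset.mem_univ, true_and, not_exists,
      not_and, not_lt] at hy
    have hyC : y ∉ C := fun h => by
      have := hy y h
      rw [hammingDist_self] at this
      omega
    have := hmax (insert y C) (by
      intro a ha b hb hab
      rcases Finset.mem_insert.1 ha with rfl | ha' <;>
        rcases Finset.mem_insert.1 hb with rfl | hb'
      · rfl
      · have := hy b hb'
        rw [hammingDist_comm] at this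
        omega
      · have := hy a ha'
        omega
      · exact hC a ha' b hb' hab)
    rw [Finset.card_insert_of_notMem hyC] at this
    omega
  have h1 := (Finset.card_le_card hcover).trans Finset.card_biUnion_le
  rw [Finset.card_univ, Fintype.card_fun, Fintype.card_fin] at h1
  refine h1.trans ((Finset.sum_le_sum fun x _ => card_hammingBall_le d x).trans ?_)
  rw [Finset.sum_const, smul_eq_mul]

/-- The probability that the noise in one channel use is at least `ρ` in absolute value. -/
def noiseTail (ρ : ℝ) : ℝ := complexGaussian.real {w | ρ ≤ ‖w‖}

theorem exists_noiseTail_lt {ε : ℝ} (hε : 0 < ε) : ∃ ρ : ℝ, 0 < ρ ∧ noiseTail ρ < ε := by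
  have h := tendsto_measure_iInter_atTop (μ := complexGaussian)
    (s := fun n : ℕ => {w : ℂ | (n : ℝ) ≤ ‖w‖})
    (fun n => (measurableSet_le measurable_const measurable_norm).nullMeasurableSet)
    (fun a b hab w (hw : (b : ℝ) ≤ ‖w‖) => (Nat.cast_le.2 hab).trans hw) ⟨0, measure_ne_top _ _⟩
  have hempty : ⋂ n : ℕ, {w : ℂ | (n : ℝ) ≤ ‖w‖} = ∅ := by
    ext w
    simp only [Set.mem_iInter, Set.mem_ofPred_eq, Set.mem_empty_iff_false, iff_false, not_forall,
      not_le]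
    exact exists_nat_gt ‖w‖
  rw [hempty, measure_empty] at h
  have h2 := (ENNReal.tendsto_toReal ENNReal.zero_ne_top).comp h
  obtain ⟨n, hn1, hn2⟩ := ((h2.eventually_lt_const (by simpa using hε)).and
    (eventually_gt_atTop 0)).exists
  exact ⟨n, by exact_mod_cast hn2, hn1⟩

/-- The points of a square grid of spacing `2 r`. -/
def gridPoint (r : ℝ) {M : ℕ} (a : Fin M × Fin M) : ℂ := ⟨2 * r * a.1, 2 * r * a.2⟩

theorem norm_gridPoint_le {r : ℝ} (hr : 0 ≤ r) {M : ℕ} (a : Fin M × Fin M) :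
    ‖gridPoint r a‖ ≤ 4 * r * M := by
  have h1 : (a.1 : ℝ) ≤ M := by exact_mod_cast a.1.2.le
  have h2 : (a.2 : ℝ) ≤ M := by exact_mod_cast a.2.2.le
  refine (Complex.norm_le_abs_re_add_abs_im _).trans ?_
  simp only [gridPoint]
  rw [abs_of_nonneg (by positivity), abs_of_nonneg (by positivity)]
  nlinarith

theorem gridPoint_eq_of_norm_lt {r : ℝ} (hr : 0 < r) {M : ℕ} {a b : Fin M × Fin M}
    (h : ‖gridPoint r a - gridPoint r b‖ < 2 * r) : a = b := by
  have key : ∀ i j : Fin M, |2 * r * (i : ℝ) - 2 * r * (j : ℝ)| < 2 * r → i = j := by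
    intro i j hij
    rw [← mul_sub, abs_mul, abs_of_pos (by positivity)] at hij
    have h1 : |(i : ℝ) - j| < 1 := by nlinarith
    have h2 : |((i : ℕ) : ℤ) - ((j : ℕ) : ℤ)| < 1 := by exact_mod_cast h1
    rw [Int.abs_lt_one_iff] at h2
    exact Fin.ext (by omega)
  refine Prod.ext (key _ _ ?_) (key _ _ ?_)
  · exact lt_of_le_of_lt (Complex.abs_re_le_norm (gridPoint r a - gridPoint r b)) h
  · exact lt_of_le_of_lt (Complex.abs_im_le_norm (gridPoint r a - gridPoint r b)) h

/-- A block code over the square grid that corrects fewer than `k` symbols received with a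
disturbance of `r` or more. -/
theorem exists_gridCode {r : ℝ} (hr : 0 < r) {e m b k : ℕ} (hk : 0 < k)
    (hb : b + m + 2 * e * (2 * k) ≤ 2 * e * m) :
    ∃ (enc : (Fin b → Bool) → Fin m → ℂ) (dec : (Fin m → ℂ) → Fin b → Bool),
      (∀ u t, ‖enc u t‖ ≤ 4 * r * 2 ^ e) ∧ Measurable dec ∧
      ∀ u v, (Finset.univ.filter fun t => r ≤ ‖v t‖).card < k → dec (enc u + v) = u := by
  classical
  let A := Fin (2 ^ e) × Fin (2 ^ e)
  have hA : Fintype.card A = 2 ^ (2 * e) := by simp [A, ← pow_add, two_mul]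
  have : Nonempty A := ⟨(⟨0, by positivity⟩, ⟨0, by positivity⟩)⟩
  obtain ⟨C, hC, hcard⟩ := exists_hammingCode A m (show 0 < 2 * k by omega)
  have hbC : Fintype.card (Fin b → Bool) ≤ Fintype.card C := by
    rw [hA, ← pow_mul, ← pow_mul, ← pow_add] at hcard
    rw [Fintype.card_fun, Fintype.card_bool, Fintype.card_fin, Fintype.card_coe]
    have h1 : 2 ^ b * 2 ^ (m + 2 * e * (2 * k)) ≤ C.card * 2 ^ (m + 2 * e * (2 * k)) := by
      refine le_trans ?_ hcard
      rw [← pow_add]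
      exact Nat.pow_le_pow_right (by norm_num) (by omega)
    exact Nat.le_of_mul_le_mul_right h1 (by positivity)
  obtain ⟨c⟩ := Function.Embedding.nonempty_of_card_le hbC
  -- The decoder sees `y` only through this finite pattern, which makes it measurable, and picks any
  -- message with fewer than `k` misfits.
  let near : (Fin m → ℂ) → Fin m → A → Prop := fun y t a => ‖y t - gridPoint r a‖ < r
  let good : (Fin m → A → Prop) → (Fin b → Bool) → Prop := fun s u =>
    (Finset.univ.filter fun t => ¬ s t ((c u : Fin m → A) t)).card < k
  let F : (Fin m → A → Prop) → Fin b → Bool := fun s =>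
    if h : ∃ u, good s u then h.choose else fun _ => false
  have hnear : Measurable near := by
    refine measurable_pi_iff.2 fun t => measurable_pi_iff.2 fun a => ?_
    refine measurable_to_prop ?_
    have : (fun y : Fin m → ℂ => near y t a) ⁻¹' {True} = {y | ‖y t - gridPoint r a‖ < r} := by
      ext y; simp [near]
    rw [this]
    exact measurableSet_lt (by fun_prop) measurable_const
  refine ⟨fun u t => gridPoint r ((c u : Fin m → A) t), fun y => F (near y), fun u t => ?_,
    (measurable_of_finite F).comp hnear, fun u v hv => ?_⟩
  · simpa using norm_gridPoint_le hr.le ((c u : Fin m → A) t)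
  · have hgood : good (near ((fun t => gridPoint r ((c u : Fin m → A) t)) + v)) u := by
      simpa [good, near] using hv
    have hex : ∃ u', good (near ((fun t => gridPoint r ((c u : Fin m → A) t)) + v)) u' :=
      ⟨u, hgood⟩
    have hch := hex.choose_spec
    simp only [F, dif_pos hex]
    set u' := hex.choose
    refine c.injective (Subtype.ext (hC _ (c u').2 _ (c u).2 ?_))
    -- Where both codewords fit `y`, their grid points are less than `2 * r` apart, hence equal. So
    -- the codewords differ in fewer than `2 * k` positions, less than the minimum distance.
    have hsub : (Finset.univ.filter fun t => (c u' : Fin m → A) t ≠ (c u : Fin m → A) t) ⊆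
        (Finset.univ.filter fun t => ¬ near ((fun t => gridPoint r ((c u : Fin m → A) t)) + v) t
          ((c u' : Fin m → A) t)) ∪ (Finset.univ.filter fun t => ¬ near
          ((fun t => gridPoint r ((c u : Fin m → A) t)) + v) t ((c u : Fin m → A) t)) := by
      intro t ht
      simp only [Finset.mem_filter, Finset.mem_univ, true_and, Finset.mem_union] at ht ⊢
      by_contra hcon
      push Not at hcon
      refine ht (gridPoint_eq_of_norm_lt hr ?_)
      have h1 := hcon.1
      have h2 := hcon.2
      simp only [near] at h1 h2
      calc _ = ‖(((fun t => gridPoint r ((c u : Fin m → A) t)) + v) t -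
            gridPoint r ((c u : Fin m → A) t)) - (((fun t => gridPoint r ((c u : Fin m → A) t)) + v) t -
            gridPoint r ((c u' : Fin m → A) t))‖ := by congr 1; ring
        _ ≤ _ := norm_sub_le _ _
        _ < 2 * r := by linarith
    have h3 := (Finset.card_le_card hsub).trans (Finset.card_union_le _ _)
    change (Finset.univ.filter fun t => (c u' : Fin m → A) t ≠ (c u : Fin m → A) t).card < 2 * k
    simp only [good] at hch hgood
    omega

/-- At high signal-to-noise ratio there are block codes of rate close to `log P`, whose decoding
error after an attenuation by `g` vanishes, uniformly in any number `C` of uses of the code. -/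
theorem eventually_exists_code {δ a g : ℝ} (hδ : 0 < δ) (ha : 0 < a) (hg : 0 < g) :
    ∃ r : ℝ, 0 < r ∧ ∀ᶠ P : ℝ in atTop, ∀ ε : ℝ, 0 < ε → ∀ C : ℝ, ∃ (m b k : ℕ)
      (enc : (Fin b → Bool) → Fin m → ℂ) (dec : (Fin m → ℂ) → Fin b → Bool),
      0 < b ∧ m * Real.logb 2 P ≤ (1 + δ) * b ∧ (∀ u t, ‖enc u t‖ ≤ a * Real.sqrt P) ∧
      Measurable dec ∧
      (∀ u v, (Finset.univ.filter fun t => r ≤ ‖v t‖).card < k → dec (enc u + v) = u) ∧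
      C * (2 ^ m * noiseTail (g * r) ^ k) ≤ ε := by
  -- Codes of length `m = k * j` correcting fewer than `k` errors lose a fraction `2 / j` of the
  -- rate; this `j` gives `j < (1 + δ) * (j - 2)`. The constant bits lost per symbol vanish against
  -- `log P`.
  obtain ⟨j, hj⟩ := exists_nat_gt (2 * (1 + δ) / δ)
  rw [div_lt_iff₀ hδ] at hj
  have hj2 : (2 : ℝ) < j := by nlinarith
  have hj3 : 2 < j := by exact_mod_cast hj2
  -- With tail below `2 ^ (-j)` the failure bound `2 ^ m * tail ^ k = (2 ^ j * tail) ^ k` decays in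
  -- `k`. The radius depends on `j` only, not on `P`.
  obtain ⟨ρ, hρ, htail⟩ := exists_noiseTail_lt (show (0 : ℝ) < 1 / 2 ^ j by positivity)
  refine ⟨ρ / g, by positivity, ?_⟩
  set r := ρ / g with hr
  have hr0 : 0 < r := by positivity
  have hgr : g * r = ρ := by rw [hr]; field_simp
  set c := 2 - 2 * Real.logb 2 (a / (4 * r)) with hc
  have hslope : 0 < (1 + δ) * (j - 2) - j := by nlinarith
  have hlogb : Tendsto (Real.logb 2) atTop atTop := Real.tendsto_logb_atTop (by norm_num)
  filter_upwards [eventually_gt_atTop 1, hlogb.eventually_ge_atTop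
    ((1 + δ) * ((j - 2) * c + j) / ((1 + δ) * (j - 2) - j)),
    hlogb.eventually_ge_atTop (2 - 2 * Real.logb 2 (a / (4 * r)))] with P hP1 hP2 hP3 ε hε C
  rw [div_le_iff₀ hslope] at hP2
  set x := Real.logb 2 P with hx
  have hx0 : 0 < x := Real.logb_pos (by norm_num) hP1
  have hsqrt : 0 < Real.sqrt P := Real.sqrt_pos.2 (by linarith)
  have hlog : Real.logb 2 (a * Real.sqrt P / (4 * r)) = Real.logb 2 (a / (4 * r)) + x / 2 := by
    rw [show a * Real.sqrt P / (4 * r) = a / (4 * r) * Real.sqrt P by ring,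
      Real.logb_mul (by positivity) hsqrt.ne', hx, Real.sqrt_eq_rpow,
      Real.logb_rpow_eq_mul_logb_of_pos (by linarith)]
    ring
  set y := Real.logb 2 (a * Real.sqrt P / (4 * r)) with hy
  have hy0 : 0 ≤ y := by linarith
  set e := ⌊y⌋₊ with he
  have he1 : (e : ℝ) ≤ y := Nat.floor_le hy0
  have he2 : y < e + 1 := Nat.lt_floor_add_one y
  have hpow : 4 * r * 2 ^ e ≤ a * Real.sqrt P := by
    have h1 : (2 : ℝ) ^ (e : ℝ) ≤ 2 ^ y := Real.rpow_le_rpow_of_exponent_le (by norm_num) he1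
    rw [hy, Real.rpow_logb (by norm_num) (by norm_num) (by positivity), Real.rpow_natCast,
      le_div_iff₀ (by positivity)] at h1
    linarith
  have hrate : (j : ℝ) * x ≤ (1 + δ) * (2 * e * (j - 2) - j) := by
    have h1 : x - c ≤ 2 * e := by rw [hc]; linarith
    have h2 : (j - 2) * (x - c) ≤ (j - 2) * (2 * e) :=
      mul_le_mul_of_nonneg_left h1 (by linarith)
    nlinarith
  obtain ⟨i, rfl⟩ : ∃ i, j = i + 2 := ⟨j - 2, by omega⟩
  push_cast at hrate hj2
  have hβ : (0 : ℝ) < 2 * e * i - (i + 2) := by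
    have : 0 < (1 + δ) * (2 * e * (i + 2 - 2) - (i + 2)) := lt_of_lt_of_le (by positivity) hrate
    have := (mul_pos_iff_of_pos_left (by linarith : 0 < 1 + δ)).1 this
    linarith
  have hβ' : i + 2 < 2 * e * i := by
    have : ((i + 2 : ℕ) : ℝ) < ((2 * e * i : ℕ) : ℝ) := by push_cast; linarith
    exact_mod_cast this
  obtain ⟨β, hβe⟩ : ∃ β, 2 * e * i = β + (i + 2) := ⟨2 * e * i - (i + 2), by omega⟩
  have hq : noiseTail (g * r) * 2 ^ (i + 2) < 1 := by
    rw [hgr]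
    rwa [lt_div_iff₀ (by positivity)] at htail
  have hq0 : 0 ≤ noiseTail (g * r) * 2 ^ (i + 2) :=
    mul_nonneg measureReal_nonneg (by positivity)
  have hlim : Tendsto (fun k : ℕ => C * (noiseTail (g * r) * 2 ^ (i + 2)) ^ k) atTop (nhds 0) := by
    simpa using (tendsto_pow_atTop_nhds_zero_of_lt_one hq0 hq).const_mul C
  obtain ⟨k, hk1, hk⟩ := ((hlim.eventually_lt_const hε).and (eventually_gt_atTop 0)).exists
  have hbits : k * β + k * (i + 2) + 2 * e * (2 * k) ≤ 2 * e * (k * (i + 2)) := by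
    have : 2 * e * (k * (i + 2)) = k * (2 * e * i) + 2 * e * (2 * k) := by ring
    rw [this, hβe]
    linarith
  obtain ⟨enc, dec, h1, h2, h3⟩ := exists_gridCode hr0 hk hbits
  refine ⟨k * (i + 2), k * β, k, enc, dec, Nat.mul_pos hk (by omega), ?_,
    fun u t => (h1 u t).trans hpow, h2, h3, ?_⟩
  · have h4 : (2 * e * i : ℝ) = β + (i + 2) := by exact_mod_cast hβe
    push_cast
    have h5 : ((i : ℝ) + 2) * x ≤ (1 + δ) * β := by nlinarith
    calc (k : ℝ) * (i + 2) * x = k * ((i + 2) * x) := by ring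
      _ ≤ k * ((1 + δ) * β) := by gcongr
      _ = _ := by ring
  · refine le_trans (le_of_eq ?_) hk1.le
    rw [mul_pow, ← pow_mul, mul_comm k]
    ring

end Coding

/-! ### From delivery plans to schemes -/

section Delivery

/-- A linear delivery plan: every file is cut into packets indexed by `Pk`, and in each of the
blocks `Bl` the transmitter superposes `L` streams. A stream is the exclusive or of its payload,
multiplied by its beamforming vector. -/
structure DeliveryPlan {K₁ K₂ L : ℕ} (N : ℕ) (γ₁ : ℝ)
    (h : User K₁ K₂ → EuclideanSpace ℂ (Fin L)) (Pk Bl : Type) [Fintype Pk] where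
  /-- the packets stored by each user -/
  cache : User K₁ K₂ → Finset (Fin N × Pk)
  card_cache_le : ∀ k, ((cache k).card : ℝ) ≤ cacheSize K₁ K₂ γ₁ k * (N * Fintype.card Pk)
  /-- the packets combined in each stream of each block -/
  payload : Demand K₁ K₂ N → Bl × Fin L → Finset (Fin N × Pk)
  /-- the beamforming vector of each stream of each block -/
  beam : Demand K₁ K₂ N → Bl × Fin L → EuclideanSpace ℂ (Fin L)
  /-- each missing packet is received in some stream, where all that interferes is either cached
  or nulled by the beamforming -/
  served : ∀ d k p, ∃ s : Bl × Fin L, (d k, p) ∉ cache k →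
    (d k, p) ∈ payload d s ∧ (∀ q ∈ payload d s, q ≠ (d k, p) → q ∈ cache k) ∧
    inner ℂ (h k) (beam d s) ≠ 0 ∧
    ∀ i, i ≠ s.2 → inner ℂ (h k) (beam d (s.1, i)) = 0 ∨ ∀ q ∈ payload d (s.1, i), q ∈ cache k

/-- The exclusive or of a set of packets of `b` bits. -/
def xorPackets {N B b : ℕ} {Pk : Type} (eB : Fin B ≃ Pk × Fin b) (W : Library N B)
    (F : Finset (Fin N × Pk)) : Fin b → Bool :=
  fun c => ∑ q ∈ F, W q.1 (eB.symm (q.2, c))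

theorem xorPackets_congr {N B b : ℕ} {Pk : Type} (eB : Fin B ≃ Pk × Fin b) {W W' : Library N B}
    {F : Finset (Fin N × Pk)} (h : ∀ q ∈ F, ∀ c, W q.1 (eB.symm (q.2, c)) =
      W' q.1 (eB.symm (q.2, c))) : xorPackets eB W F = xorPackets eB W' F :=
  funext fun c => Finset.sum_congr rfl fun q hq => h q hq c

/-- Completes the contents of a cache to a library, in an arbitrary way. -/
def extendCache {N B : ℕ} {c : Finset (Fin N × Fin B)} (z : c → Bool) : Library N B :=
  fun f x => if h : (f, x) ∈ c then z ⟨(f, x), h⟩ else false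

namespace DeliveryPlan

variable {K₁ K₂ L N B b n m : ℕ} {γ₁ : ℝ} {h : User K₁ K₂ → EuclideanSpace ℂ (Fin L)}
  {Pk Bl : Type} [Fintype Pk]

/-- The stream that serves a packet to a user. -/
def source (D : DeliveryPlan N γ₁ h Pk Bl) (d : Demand K₁ K₂ N) (k : User K₁ K₂) (p : Pk) :
    Bl × Fin L := (D.served d k p).choose

/-- The bits stored by a user. -/
def bitCache (D : DeliveryPlan N γ₁ h Pk Bl) (eB : Fin B ≃ Pk × Fin b) (k : User K₁ K₂) :
    Finset (Fin N × Fin B) :=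
  open Classical in Finset.univ.filter fun x => (x.1, (eB x.2).1) ∈ D.cache k

/-- The transmitted block of vectors. -/
def encode (D : DeliveryPlan N γ₁ h Pk Bl) (eB : Fin B ≃ Pk × Fin b) (eN : Fin n ≃ Bl × Fin m)
    (enc : (Fin b → Bool) → Fin m → ℂ) (d : Demand K₁ K₂ N) (W : Library N B) (t : Fin n) :
    EuclideanSpace ℂ (Fin L) :=
  ∑ i, enc (xorPackets eB W (D.payload d ((eN t).1, i))) (eN t).2 • D.beam d ((eN t).1, i)

/-- The estimate of a packet from the received signal `y` and a library `W` that agrees with the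
true one on the cached bits. -/
def decodePacket (D : DeliveryPlan N γ₁ h Pk Bl) (eB : Fin B ≃ Pk × Fin b)
    (eN : Fin n ≃ Bl × Fin m) (enc : (Fin b → Bool) → Fin m → ℂ)
    (dec : (Fin m → ℂ) → Fin b → Bool) (d : Demand K₁ K₂ N) (k : User K₁ K₂)
    (W : Library N B) (p : Pk) (y : Fin n → ℂ) : Fin b → Bool :=
  open Classical in
  dec (fun t => (y (eN.symm ((D.source d k p).1, t)) -
      ∑ i ∈ Finset.univ.erase (D.source d k p).2,
        enc (xorPackets eB W (D.payload d ((D.source d k p).1, i))) t *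
          inner ℂ (h k) (D.beam d ((D.source d k p).1, i))) /
      inner ℂ (h k) (D.beam d (D.source d k p))) -
    xorPackets eB W ((D.payload d (D.source d k p)).erase (d k, p))

theorem measurable_decodePacket (D : DeliveryPlan N γ₁ h Pk Bl) (eB : Fin B ≃ Pk × Fin b)
    (eN : Fin n ≃ Bl × Fin m) (enc : (Fin b → Bool) → Fin m → ℂ)
    {dec : (Fin m → ℂ) → Fin b → Bool} (hdec : Measurable dec) (d : Demand K₁ K₂ N)
    (k : User K₁ K₂) (W : Library N B) (p : Pk) :
    Measurable (D.decodePacket eB eN enc dec d k W p) := by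
  unfold decodePacket
  refine (measurable_of_finite fun u : Fin b → Bool => u - _).comp (hdec.comp ?_)
  refine measurable_pi_iff.2 fun t => ?_
  fun_prop

theorem decodePacket_eq (D : DeliveryPlan N γ₁ h Pk Bl) (eB : Fin B ≃ Pk × Fin b)
    (eN : Fin n ≃ Bl × Fin m) {enc : (Fin b → Bool) → Fin m → ℂ}
    {dec : (Fin m → ℂ) → Fin b → Bool} {r g : ℝ} {l : ℕ}
    (hdec : ∀ u v, (Finset.univ.filter fun t => r ≤ ‖v t‖).card < l → dec (enc u + v) = u)
    (hr : 0 < r) (hg : ∀ d s k, inner ℂ (h k) (D.beam d s) ≠ 0 → g ≤ ‖inner ℂ (h k) (D.beam d s)‖)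
    (d : Demand K₁ K₂ N) (k : User K₁ K₂) {W V : Library N B}
    (hV : ∀ q ∈ D.cache k, ∀ c, V q.1 (eB.symm (q.2, c)) = W q.1 (eB.symm (q.2, c)))
    {p : Pk} (hp : (d k, p) ∉ D.cache k) (w : Fin n → ℂ)
    (hw : (Finset.univ.filter fun t : Fin m =>
      g * r ≤ ‖w (eN.symm ((D.source d k p).1, t))‖).card < l) :
    D.decodePacket eB eN enc dec d k V p
      (fun t => inner ℂ (h k) (D.encode eB eN enc d W t) + w t) =
      fun c => W (d k) (eB.symm (p, c)) := by
  classical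
  obtain ⟨h1, h2, h3, h4⟩ := (D.served d k p).choose_spec hp
  change (d k, p) ∈ D.payload d (D.source d k p) at h1
  change ∀ q ∈ D.payload d (D.source d k p), _ at h2
  change inner ℂ (h k) (D.beam d (D.source d k p)) ≠ 0 at h3
  change ∀ i, i ≠ (D.source d k p).2 → inner ℂ (h k) (D.beam d ((D.source d k p).1, i)) = 0 ∨
    ∀ q ∈ D.payload d ((D.source d k p).1, i), q ∈ D.cache k at h4
  unfold decodePacket encode
  set s := D.source d k p with hs
  have hrec : (fun t => (inner ℂ (h k) (∑ i, enc (xorPackets eB W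
      (D.payload d ((eN (eN.symm (s.1, t))).1, i))) (eN (eN.symm (s.1, t))).2 •
      D.beam d ((eN (eN.symm (s.1, t))).1, i)) + w (eN.symm (s.1, t)) -
      ∑ i ∈ Finset.univ.erase s.2, enc (xorPackets eB V (D.payload d (s.1, i))) t *
          inner ℂ (h k) (D.beam d (s.1, i))) / inner ℂ (h k) (D.beam d s)) =
      enc (xorPackets eB W (D.payload d s)) +
        fun t => w (eN.symm (s.1, t)) / inner ℂ (h k) (D.beam d s) := by
    funext t
    simp only [Equiv.apply_symm_apply, inner_sum, inner_smul_right, Pi.add_apply]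
    rw [← Finset.add_sum_erase _ _ (Finset.mem_univ s.2)]
    have : ∑ i ∈ Finset.univ.erase s.2, enc (xorPackets eB W (D.payload d (s.1, i))) t *
          inner ℂ (h k) (D.beam d (s.1, i)) =
        ∑ i ∈ Finset.univ.erase s.2, enc (xorPackets eB V (D.payload d (s.1, i))) t *
          inner ℂ (h k) (D.beam d (s.1, i)) := by
      refine Finset.sum_congr rfl fun i hi => ?_
      rcases h4 i (Finset.ne_of_mem_erase hi) with h0 | hc
      · rw [h0]; simp
      · rw [xorPackets_congr eB fun q hq c => (hV q (hc q hq) c).symm]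
    rw [this]
    simp only [Prod.mk.eta]
    field_simp
    ring
  rw [hrec, hdec]
  · funext c
    have h5 : xorPackets eB V ((D.payload d s).erase (d k, p)) =
        xorPackets eB W ((D.payload d s).erase (d k, p)) :=
      xorPackets_congr eB fun q hq c =>
        hV q (h2 q (Finset.mem_of_mem_erase hq) (Finset.ne_of_mem_erase hq)) c
    rw [h5]
    simp only [Pi.sub_apply, xorPackets]
    rw [← Finset.add_sum_erase _ _ h1]
    simp
  · refine lt_of_le_of_lt (Finset.card_le_card fun t ht => ?_) hw
    simp only [Finset.mem_filter, Finset.mem_univ, true_and] at ht ⊢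
    rw [norm_div, le_div_iff₀ (norm_pos_iff.2 h3)] at ht
    refine le_trans ?_ ht
    rw [mul_comm]
    exact mul_le_mul_of_nonneg_left (hg d s k h3) hr.le

theorem card_bitCache_le (D : DeliveryPlan N γ₁ h Pk Bl) (eB : Fin B ≃ Pk × Fin b)
    (k : User K₁ K₂) :
    ((D.bitCache eB k).card : ℝ) ≤ cacheSize K₁ K₂ γ₁ k * (N * B) := by
  classical
  have h1 : (D.bitCache eB k).card ≤ ((D.cache k) ×ˢ (Finset.univ : Finset (Fin b))).card := by
    refine Finset.card_le_card_of_injOn (fun x => ((x.1, (eB x.2).1), (eB x.2).2)) ?_ ?_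
    · intro x hx
      simpa [bitCache] using hx
    · rintro ⟨f, x⟩ - ⟨f', x'⟩ - hxx
      simp only [Prod.mk.injEq] at hxx
      exact Prod.ext hxx.1.1 (eB.injective (Prod.ext hxx.1.2 hxx.2))
  have hB : (B : ℝ) = Fintype.card Pk * b := by
    have := Fintype.card_congr eB
    simp only [Fintype.card_fin, Fintype.card_prod] at this
    exact_mod_cast this
  rw [Finset.card_product, Finset.card_univ, Fintype.card_fin] at h1
  calc ((D.bitCache eB k).card : ℝ) ≤ (D.cache k).card * b := by exact_mod_cast h1
    _ ≤ cacheSize K₁ K₂ γ₁ k * (N * Fintype.card Pk) * b := by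
        gcongr; exact D.card_cache_le k
    _ = _ := by rw [hB]; ring

/-- The placement-and-delivery scheme that uses a block code in each stream of a plan. -/
def scheme (D : DeliveryPlan N γ₁ h Pk Bl) (eB : Fin B ≃ Pk × Fin b) (eN : Fin n ≃ Bl × Fin m)
    (enc : (Fin b → Bool) → Fin m → ℂ) (dec : (Fin m → ℂ) → Fin b → Bool)
    (hdec : Measurable dec) : UncodedScheme K₁ K₂ N L B n γ₁ where
  cache := D.bitCache eB
  card_cache_le := D.card_bitCache_le eB
  encode := D.encode eB eN enc
  decode d k y z x :=
    open Classical in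
    if (d k, (eB x).1) ∈ D.cache k then extendCache z (d k) x
    else D.decodePacket eB eN enc dec d k (extendCache z) (eB x).1 y (eB x).2
  measurable_decode d k z := by
    refine measurable_pi_iff.2 fun x => ?_
    split_ifs
    · exact measurable_const
    · exact (measurable_pi_apply _).comp (D.measurable_decodePacket eB eN enc hdec d k _ _)

theorem scheme_succeeds (D : DeliveryPlan N γ₁ h Pk Bl) (eB : Fin B ≃ Pk × Fin b)
    (eN : Fin n ≃ Bl × Fin m) {enc : (Fin b → Bool) → Fin m → ℂ}
    {dec : (Fin m → ℂ) → Fin b → Bool} (hmeas : Measurable dec) {r g : ℝ} {l : ℕ}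
    (hdec : ∀ u v, (Finset.univ.filter fun t => r ≤ ‖v t‖).card < l → dec (enc u + v) = u)
    (hr : 0 < r) (hg : ∀ d s k, inner ℂ (h k) (D.beam d s) ≠ 0 → g ≤ ‖inner ℂ (h k) (D.beam d s)‖)
    (d : Demand K₁ K₂ N) (W : Library N B) {w : User K₁ K₂ → Fin n → ℂ}
    (hw : ∀ k β, (Finset.univ.filter fun t : Fin m => g * r ≤ ‖w k (eN.symm (β, t))‖).card < l) :
    (D.scheme eB eN enc dec hmeas).Succeeds h d W w := by
  intro k
  have hV : ∀ q ∈ D.cache k, ∀ c, extendCache (c := D.bitCache eB k)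
      (fun p => W p.1.1 p.1.2) q.1 (eB.symm (q.2, c)) = W q.1 (eB.symm (q.2, c)) := by
    intro q hq c
    have : (q.1, eB.symm (q.2, c)) ∈ D.bitCache eB k := by simpa [bitCache] using hq
    rw [extendCache, dif_pos this]
  funext x
  simp only [scheme]
  split_ifs with hx
  · have := hV _ hx (eB x).2
    simpa using this
  · have := D.decodePacket_eq eB eN hdec hr hg d k hV hx (w k) (hw k _)
    have h2 := congrFun this (eB x).2
    simp only [Prod.mk.eta, Equiv.symm_apply_apply] at h2
    exact h2

theorem norm_encode_le (D : DeliveryPlan N γ₁ h Pk Bl) (eB : Fin B ≃ Pk × Fin b)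
    (eN : Fin n ≃ Bl × Fin m) {enc : (Fin b → Bool) → Fin m → ℂ} {A V : ℝ} (hA : 0 ≤ A)
    (henc : ∀ u t, ‖enc u t‖ ≤ A) (hV : ∀ d β, ∑ i, ‖D.beam d (β, i)‖ ≤ V)
    (d : Demand K₁ K₂ N) (W : Library N B) (t : Fin n) :
    ‖D.encode eB eN enc d W t‖ ≤ A * V := by
  unfold encode
  calc _ ≤ ∑ i, A * ‖D.beam d ((eN t).1, i)‖ := by
        refine (norm_sum_le _ _).trans (Finset.sum_le_sum fun i _ => ?_)
        rw [norm_smul]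
        exact mul_le_mul_of_nonneg_right (henc _ _) (norm_nonneg _)
    _ ≤ _ := by
        rw [← Finset.mul_sum]
        exact mul_le_mul_of_nonneg_left (hV d _) hA

end DeliveryPlan

theorem noise_many_large_le {K₁ K₂ n m : ℕ} (k : User K₁ K₂) {idx : Fin m → Fin n}
    (hidx : Function.Injective idx) (ρ : ℝ) (l : ℕ) :
    (noise K₁ K₂ n).real {w | l ≤ (Finset.univ.filter fun t => ρ ≤ ‖w k (idx t)‖).card} ≤
      2 ^ m * noiseTail ρ ^ l := by
  classical
  have hsub : {w : User K₁ K₂ → Fin n → ℂ |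
      l ≤ (Finset.univ.filter fun t => ρ ≤ ‖w k (idx t)‖).card} ⊆
      ⋃ T ∈ Finset.powersetCard l (Finset.univ : Finset (Fin m)),
        {w : User K₁ K₂ → Fin n → ℂ | ∀ t ∈ T, ρ ≤ ‖w k (idx t)‖} := by
    intro w hw
    obtain ⟨T, hT, hTc⟩ := Finset.exists_subset_card_eq hw
    simp only [Set.mem_iUnion]
    refine ⟨T, Finset.mem_powersetCard.2 ⟨Finset.subset_univ _, hTc⟩, fun t ht => ?_⟩
    simpa using hT ht
  have hbox : ∀ T ∈ Finset.powersetCard l (Finset.univ : Finset (Fin m)),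
      (noise K₁ K₂ n).real {w | ∀ t ∈ T, ρ ≤ ‖w k (idx t)‖} = noiseTail ρ ^ l := by
    intro T hT
    have hs : MeasurableSet {c : ℂ | ρ ≤ ‖c‖} := measurableSet_le measurable_const measurable_norm
    have e1 : {w : User K₁ K₂ → Fin n → ℂ | ∀ t ∈ T, ρ ≤ ‖w k (idx t)‖} =
        (fun w => w k) ⁻¹' (Set.univ.pi fun s => if s ∈ T.image idx then {c : ℂ | ρ ≤ ‖c‖}
          else Set.univ) := by
      ext w
      simp only [Set.mem_ofPred_eq, Set.mem_preimage, Set.mem_univ_pi]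
      constructor
      · intro hw s
        split_ifs with hs
        · obtain ⟨t, ht, rfl⟩ := Finset.mem_image.1 hs
          exact hw t ht
        · trivial
      · intro hw t ht
        have := hw (idx t)
        rwa [if_pos (Finset.mem_image_of_mem _ ht)] at this
    have hm : MeasurableSet (Set.univ.pi fun s : Fin n => if s ∈ T.image idx then
        {c : ℂ | ρ ≤ ‖c‖} else Set.univ) :=
      MeasurableSet.univ_pi fun s => by split_ifs <;> simp [hs]
    rw [e1, measureReal_def, noise,
      (measurePreserving_eval (fun _ : User K₁ K₂ => Measure.pi fun _ : Fin n => complexGaussian)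
        k).measure_preimage hm.nullMeasurableSet, Measure.pi_pi]
    have e2 : ∀ s, complexGaussian (if s ∈ T.image idx then {c : ℂ | ρ ≤ ‖c‖} else Set.univ) =
        if s ∈ T.image idx then complexGaussian {c : ℂ | ρ ≤ ‖c‖} else 1 := by
      intro s; split_ifs <;> simp
    simp only [e2, Finset.prod_ite_mem, Finset.univ_inter, Finset.prod_const]
    rw [Finset.card_image_of_injective _ hidx, (Finset.mem_powersetCard.1 hT).2,
      ENNReal.toReal_pow]
    rfl
  refine (measureReal_mono hsub (measure_ne_top _ _)).trans ((measureReal_biUnion_finset_le _ _).trans ?_)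
  rw [Finset.sum_congr rfl hbox, Finset.sum_const, nsmul_eq_mul]
  refine mul_le_mul_of_nonneg_right ?_ (pow_nonneg measureReal_nonneg _)
  have : (Finset.powersetCard l (Finset.univ : Finset (Fin m))).card ≤ 2 ^ m := by
    rw [Finset.card_powersetCard, Finset.card_univ, Fintype.card_fin]
    exact Nat.choose_le_two_pow _ _
  exact_mod_cast this

theorem exists_pos_le_norm {ι : Type*} [Finite ι] (f : ι → ℂ) :
    ∃ g : ℝ, 0 < g ∧ ∀ i, f i ≠ 0 → g ≤ ‖f i‖ := by
  classical
  have := Fintype.ofFinite ι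
  by_cases hne : (Finset.univ.filter fun i => f i ≠ 0).Nonempty
  · obtain ⟨i, hi, hmin⟩ := Finset.exists_min_image _ (fun i => ‖f i‖) hne
    simp only [Finset.mem_filter, Finset.mem_univ, true_and] at hi hmin
    exact ⟨‖f i‖, norm_pos_iff.2 hi, hmin⟩
  · rw [Finset.not_nonempty_iff_eq_empty, Finset.filter_eq_empty_iff] at hne
    exact ⟨1, one_pos, fun i hi => absurd hi (hne (Finset.mem_univ i))⟩

/-- A delivery plan achieves, at high signal-to-noise ratio, any delay larger than the number of
its blocks divided by the number of packets of a file. -/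
theorem DeliveryPlan.eventually_achievableAt {K₁ K₂ L N : ℕ} {γ₁ : ℝ}
    {h : User K₁ K₂ → EuclideanSpace ℂ (Fin L)} {Pk Bl : Type} [Fintype Pk] [Nonempty Pk]
    [Fintype Bl] (D : DeliveryPlan N γ₁ h Pk Bl) {δ : ℝ} (hδ : 0 < δ) :
    ∀ᶠ P : ℝ in atTop, AchievableAt N γ₁ h P
      ((1 + δ) * (Fintype.card Bl / Fintype.card Pk)) := by
  classical
  obtain ⟨g, hg0, hg⟩ := exists_pos_le_norm
    fun x : Demand K₁ K₂ N × (Bl × Fin L) × User K₁ K₂ => inner ℂ (h x.2.2) (D.beam x.1 x.2.1)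
  set V : ℝ := 1 + ∑ d, ∑ β, ∑ i, ‖D.beam d (β, i)‖ with hVdef
  have hV0 : 0 < V := by
    have : 0 ≤ ∑ d, ∑ β, ∑ i, ‖D.beam d (β, i)‖ :=
      Finset.sum_nonneg fun d _ => Finset.sum_nonneg fun β _ =>
        Finset.sum_nonneg fun i _ => norm_nonneg _
    positivity
  have hV : ∀ d β, ∑ i, ‖D.beam d (β, i)‖ ≤ V := by
    intro d β
    have h1 : ∑ i, ‖D.beam d (β, i)‖ ≤ ∑ β, ∑ i, ‖D.beam d (β, i)‖ :=
      Finset.single_le_sum (f := fun β => ∑ i, ‖D.beam d (β, i)‖)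
        (fun β _ => Finset.sum_nonneg fun i _ => norm_nonneg _) (Finset.mem_univ β)
    have h2 : ∑ β, ∑ i, ‖D.beam d (β, i)‖ ≤ ∑ d, ∑ β, ∑ i, ‖D.beam d (β, i)‖ :=
      Finset.single_le_sum (f := fun d => ∑ β, ∑ i, ‖D.beam d (β, i)‖)
        (fun d _ => Finset.sum_nonneg fun β _ => Finset.sum_nonneg fun i _ => norm_nonneg _)
        (Finset.mem_univ d)
    linarith
  obtain ⟨r, hr, hcode⟩ := eventually_exists_code hδ (show 0 < 1 / V by positivity) hg0
  filter_upwards [hcode, eventually_gt_atTop 0] with P hP hP0 ε hε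
  obtain ⟨m, b, l, enc, dec, hb, hrate, henc, hmeas, hdec, hsmall⟩ :=
    hP ε hε (Fintype.card (User K₁ K₂) * Fintype.card Bl)
  let eB : Fin (Fintype.card Pk * b) ≃ Pk × Fin b :=
    finProdFinEquiv.symm.trans ((Fintype.equivFin Pk).symm.prodCongr (Equiv.refl _))
  let eN : Fin (Fintype.card Bl * m) ≃ Bl × Fin m :=
    finProdFinEquiv.symm.trans ((Fintype.equivFin Bl).symm.prodCongr (Equiv.refl _))
  have hPk : 0 < Fintype.card Pk := Fintype.card_pos
  refine ⟨_, _, D.scheme eB eN enc dec hmeas, Nat.mul_pos hPk hb, ?_, ?_, ?_⟩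
  · intro d t
    rw [div_le_iff₀ (by exact_mod_cast Fintype.card_pos)]
    calc _ ≤ ∑ _W : Library N (Fintype.card Pk * b), P := by
          refine Finset.sum_le_sum fun W _ => ?_
          have h1 : ‖D.encode eB eN enc d W t‖ ≤ 1 / V * Real.sqrt P * V :=
            D.norm_encode_le eB eN (by positivity) henc hV d W t
          have h2 : 1 / V * Real.sqrt P * V = Real.sqrt P := by field_simp
          rw [h2] at h1
          calc _ ≤ Real.sqrt P ^ 2 := pow_le_pow_left₀ (norm_nonneg _) h1 2
            _ = P := Real.sq_sqrt hP0.le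
      _ = _ := by
          rw [Finset.sum_const, Finset.card_univ, nsmul_eq_mul, mul_comm]
  · intro d
    rw [UncodedScheme.errorProb, div_le_iff₀ (by exact_mod_cast Fintype.card_pos)]
    calc _ ≤ ∑ _W : Library N (Fintype.card Pk * b), ε := by
          refine Finset.sum_le_sum fun W _ => ?_
          have hsub : {w | ¬ (D.scheme eB eN enc dec hmeas).Succeeds h d W w} ⊆
              ⋃ q ∈ (Finset.univ : Finset (User K₁ K₂ × Bl)), {w | l ≤ (Finset.univ.filter
                fun t : Fin m => g * r ≤ ‖w q.1 (eN.symm (q.2, t))‖).card} := by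
            intro w hw
            by_contra hcon
            refine hw (D.scheme_succeeds eB eN hmeas hdec hr
              (fun d s k hne => hg (d, s, k) hne) d W fun k β => ?_)
            simp only [Set.mem_iUnion, not_exists] at hcon
            have := hcon (k, β) (Finset.mem_univ _)
            simpa using this
          refine (measureReal_mono hsub (measure_ne_top _ _)).trans ((measureReal_biUnion_finset_le _ _).trans ?_)
          calc _ ≤ ∑ _q : User K₁ K₂ × Bl, 2 ^ m * noiseTail (g * r) ^ l := by
                refine Finset.sum_le_sum fun q _ => noise_many_large_le q.1 ?_ _ _
                intro t t' htt
                simpa using htt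
            _ ≤ ε := by
                rw [Finset.sum_const, Finset.card_univ, Fintype.card_prod, nsmul_eq_mul,
                  Nat.cast_mul]
                exact hsmall
      _ = _ := by
          rw [Finset.sum_const, Finset.card_univ, nsmul_eq_mul, mul_comm]
  · have hb' : (0 : ℝ) < b := by exact_mod_cast hb
    have hPk' : (0 : ℝ) < Fintype.card Pk := by exact_mod_cast hPk
    push_cast
    rw [div_le_iff₀ (by positivity)]
    calc (Fintype.card Bl * m : ℝ) * Real.logb 2 P = Fintype.card Bl * (m * Real.logb 2 P) := by ring
      _ ≤ Fintype.card Bl * ((1 + δ) * b) := by gcongr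
      _ = _ := by field_simp

end Delivery

/-! ### The delivery plan -/

section Plan

/-- Zero-forcing: a vector orthogonal to the channels of any `L - 1` users and to no other. -/
theorem GeneralPosition.exists_nulling {K₁ K₂ L : ℕ} {h : User K₁ K₂ → EuclideanSpace ℂ (Fin L)}
    (hh : GeneralPosition h) (s : Finset (User K₁ K₂)) (hs : s.card + 1 = L) :
    ∃ v, (∀ k ∈ s, inner ℂ (h k) v = 0) ∧ ∀ k, k ∉ s → inner ℂ (h k) v ≠ 0 := by
  classical
  let U : Submodule ℂ (EuclideanSpace ℂ (Fin L)) := Submodule.span ℂ (s.image h : Set _)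
  have hU : Module.finrank ℂ U ≤ s.card :=
    (finrank_span_finset_le_card _).trans Finset.card_image_le
  have hne : Uᗮ ≠ ⊥ := by
    intro hbot
    rw [Submodule.orthogonal_eq_bot_iff] at hbot
    rw [hbot, finrank_top, finrank_euclideanSpace_fin] at hU
    omega
  obtain ⟨v, hv, hv0⟩ := Submodule.exists_mem_ne_zero_of_ne_bot hne
  have horth : ∀ k ∈ s, inner ℂ (h k) v = 0 := fun k hk =>
    (Submodule.mem_orthogonal U v).1 hv _
      (Submodule.subset_span (Finset.mem_coe.2 (Finset.mem_image_of_mem h hk)))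
  refine ⟨v, horth, fun k hk hzero => hv0 ?_⟩
  have hli := hh (insert k s) (by rw [Finset.card_insert_of_notMem hk, hs])
  have htop := hli.span_eq_top_of_card_eq_finrank' (by
    rw [Fintype.card_coe, Finset.card_insert_of_notMem hk, hs, finrank_euclideanSpace_fin])
  have hmem : v ∈ (Submodule.span ℂ (Set.range fun k' : (insert k s : Finset _) => h k'))ᗮ := by
    rw [Submodule.mem_orthogonal]
    intro x hx
    induction hx using Submodule.span_induction with
    | mem x hx =>
      obtain ⟨⟨k', hk'⟩, rfl⟩ := hx
      rcases Finset.mem_insert.1 hk' with rfl | hk'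
      · exact hzero
      · exact horth _ hk'
    | zero => simp
    | add x y _ _ hx hy => rw [inner_add_left, hx, hy, add_zero]
    | smul c x _ hx => rw [inner_smul_left, hx, mul_zero]
  rw [htop, Submodule.top_orthogonal_eq_bot] at hmem
  exact (Submodule.mem_bot ℂ).1 hmem

/-- McNaughton's wrap-around rule: `L` machines that run for a time `ℓ` can process a job of
length `a ≤ ℓ` and `K` jobs of length `b ≤ ℓ` that fill them completely, so that no job is on two
machines at the same time. -/
theorem exists_schedule {a b K L ℓ : ℕ} (htotal : a + K * b = L * ℓ) (ha : a ≤ ℓ)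
    (hb : K ≠ 0 → b ≤ ℓ) :
    ∃ E : Fin L × Fin ℓ ≃ Fin a ⊕ Fin K × Fin b,
      (∀ s i i' x x', E (i, s) = Sum.inl x → E (i', s) = Sum.inl x' → i = i') ∧
      ∀ s i i' g y y', E (i, s) = Sum.inr (g, y) → E (i', s) = Sum.inr (g, y') → i = i' := by
  let F : Fin a ⊕ Fin K × Fin b ≃ Fin (L * ℓ) :=
    ((Equiv.refl _).sumCongr finProdFinEquiv).trans (finSumFinEquiv.trans (finCongr htotal))
  let E : Fin L × Fin ℓ ≃ Fin a ⊕ Fin K × Fin b := finProdFinEquiv.trans F.symm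
  have hval : ∀ p : Fin L × Fin ℓ, (p.2 : ℕ) + ℓ * p.1 = F (E p) := by
    intro p
    simp [E, finProdFinEquiv]
  have hwrap : ∀ (s : Fin ℓ) (i i' : Fin L), (s : ℕ) + ℓ * i < s + ℓ * i' + ℓ →
      (s : ℕ) + ℓ * i' < s + ℓ * i + ℓ → i = i' := by
    intro s i i' h1 h2
    have h3 : (i : ℕ) < i' + 1 := by
      refine Nat.lt_of_mul_lt_mul_left (a := ℓ) ?_
      rw [mul_add]; omega
    have h4 : (i' : ℕ) < i + 1 := by
      refine Nat.lt_of_mul_lt_mul_left (a := ℓ) ?_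
      rw [mul_add]; omega
    exact Fin.ext (by omega)
  refine ⟨E, fun s i i' x x' h1 h2 => hwrap s i i' ?_ ?_, fun s i i' g y y' h1 h2 =>
    hwrap s i i' ?_ ?_⟩
  all_goals
    have e1 := hval (i, s)
    have e2 := hval (i', s)
    rw [h1] at e1
    rw [h2] at e2
    simp [F, finProdFinEquiv] at e1 e2
  · omega
  · omega
  · have := hb (by rintro rfl; exact g.elim0)
    omega
  · have := hb (by rintro rfl; exact g.elim0)
    omega

/-- A correspondence between the positions `y` in the jobs of the sets `σ` of `t + 1` users, and
the packets of the sets `τ` of `t` users: `τ` is obtained from `σ` by removing a user. -/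
theorem exists_packet_labelling {K t u L : ℕ} (hK : t + u = K) (hu : 0 < u) :
    ∃ (rem : Finset (Fin K) → Fin (L * (t + 1)) → Fin K)
      (pos : Finset (Fin K) → Fin (L * (t + 1)) → Fin (L * u)),
      (∀ σ : Finset (Fin K), σ.card = t + 1 → ∀ y, rem σ y ∈ σ) ∧
      ∀ τ : Finset (Fin K), τ.card = t → ∀ x, ∃ σ : Finset (Fin K), σ.card = t + 1 ∧
        ∃ y, σ.erase (rem σ y) = τ ∧ pos σ y = x := by
  classical
  have : NeZero u := ⟨hu.ne'⟩
  have : NeZero K := ⟨by omega⟩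
  have h1 : ∀ τ : Finset (Fin K), ∃ f : Fin K → Fin u, τ.card = t → ∀ r, ∃ j, j ∉ τ ∧ f j = r := by
    intro τ
    by_cases hτ : τ.card = t
    · have hc : τᶜ.card = u := by rw [Finset.card_compl, Fintype.card_fin, hτ]; omega
      let e := Finset.equivFinOfCardEq hc
      refine ⟨fun j => if hj : j ∈ τᶜ then e ⟨j, hj⟩ else 0, fun _ r => ?_⟩
      refine ⟨e.symm r, Finset.mem_compl.1 (e.symm r).2, ?_⟩
      exact (dif_pos (e.symm r).2).trans (by simp)
    · exact ⟨fun _ => 0, fun h => absurd h hτ⟩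
  choose rk hrk using h1
  have h2 : ∀ σ : Finset (Fin K), ∃ f : Fin (t + 1) → Fin K, σ.card = t + 1 →
      (∀ j, f j ∈ σ) ∧ ∀ k ∈ σ, ∃ j, f j = k := by
    intro σ
    by_cases hσ : σ.card = t + 1
    · let e := Finset.equivFinOfCardEq hσ
      exact ⟨fun j => (e.symm j : Fin K), fun _ => ⟨fun j => (e.symm j).2, fun k hk =>
        ⟨e ⟨k, hk⟩, by simp⟩⟩⟩
    · exact ⟨fun _ => 0, fun h => absurd h hσ⟩
  choose el hel using h2
  refine ⟨fun σ y => el σ (finProdFinEquiv.symm y).2,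
    fun σ y => finProdFinEquiv ((finProdFinEquiv.symm y).1,
      rk (σ.erase (el σ (finProdFinEquiv.symm y).2)) (el σ (finProdFinEquiv.symm y).2)),
    fun σ hσ y => (hel σ hσ).1 _, fun τ hτ x => ?_⟩
  obtain ⟨j, hj, hjr⟩ := hrk τ hτ (finProdFinEquiv.symm x).2
  have hσ : (insert j τ).card = t + 1 := by rw [Finset.card_insert_of_notMem hj, hτ]
  obtain ⟨i, hi⟩ := (hel _ hσ).2 j (Finset.mem_insert_self j τ)
  refine ⟨insert j τ, hσ, finProdFinEquiv ((finProdFinEquiv.symm x).1, i), ?_, ?_⟩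
  · simp only [Equiv.symm_apply_apply, hi, Finset.erase_insert hj]
  · simp only [Equiv.symm_apply_apply, hi, Finset.erase_insert hj, hjr, Prod.mk.eta,
      Equiv.apply_symm_apply]

/-- The packets of a file: the users that cache a packet, and an index. -/
abbrev Packet (K t q : ℕ) : Type := {τ : Finset (Fin K) // τ.card = t} × Fin q

theorem card_packet (K t q : ℕ) : Fintype.card (Packet K t q) = K.choose t * q := by
  rw [Fintype.card_prod, Fintype.card_finset_len, Fintype.card_fin, Fintype.card_fin]

/-- The packets stored by a user. -/
def packetCache (K₁ K₂ N t q : ℕ) (k : User K₁ K₂) : Finset (Fin N × Packet K₁ t q) :=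
  open Classical in Finset.univ.filter fun p => ∃ j ∈ p.2.1.1, k = Sum.inl j

theorem card_packetCache_le {K₁ K₂ N t u q : ℕ} {γ : ℝ} (hK : t + u = K₁)
    (ht : (K₁ : ℝ) * γ = t) (k : User K₁ K₂) :
    ((packetCache K₁ K₂ N t q k).card : ℝ) ≤
      cacheSize K₁ K₂ γ k * (N * Fintype.card (Packet K₁ t q)) := by
  classical
  rcases k with k | g
  · set T : Finset {τ : Finset (Fin K₁) // τ.card = t} :=
      Finset.univ.filter fun τ => k ∈ τ.1 with hT
    have h1 : packetCache K₁ K₂ N t q (Sum.inl k) =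
        (Finset.univ : Finset (Fin N)) ×ˢ (T ×ˢ (Finset.univ : Finset (Fin q))) := by
      ext p; simp [packetCache, hT]
    have h2 : (Finset.univ.filter fun τ : {τ : Finset (Fin K₁) // τ.card = t} => k ∉ τ.1).card =
        (K₁ - 1).choose t := by
      have : (Finset.univ.filter fun τ : {τ : Finset (Fin K₁) // τ.card = t} => k ∉ τ.1).map
          (Function.Embedding.subtype _) = Finset.powersetCard t (Finset.univ.erase k) := by
        ext τ
        simp only [Finset.mem_map, Finset.mem_filter, Finset.mem_univ, true_and,
          Function.Embedding.subtype_apply, Subtype.exists, exists_and_right, exists_eq_right,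
          Finset.mem_powersetCard, Finset.subset_erase, Finset.subset_univ]
        exact ⟨fun ⟨h, h'⟩ => ⟨h', h⟩, fun ⟨h, h'⟩ => ⟨h', h⟩⟩
      rw [← Finset.card_map, this, Finset.card_powersetCard,
        Finset.card_erase_of_mem (Finset.mem_univ k), Finset.card_univ, Fintype.card_fin]
    have h3 : T.card + (K₁ - 1).choose t = K₁.choose t := by
      rw [← h2, hT, Finset.card_filter_add_card_filter_not, Finset.card_univ,
        Fintype.card_finset_len, Fintype.card_fin]
    obtain ⟨K, rfl⟩ : ∃ K, K₁ = K + 1 := ⟨K₁ - 1, by have := k.pos; omega⟩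
    have h4 := Nat.choose_mul_succ_eq K t
    rw [show K + 1 - t = u by omega] at h4
    simp only [Nat.add_sub_cancel] at h3
    have h3' : (T.card : ℝ) + K.choose t = (K + 1).choose t := by exact_mod_cast h3
    have h4' : (K.choose t : ℝ) * (K + 1) = (K + 1).choose t * u := by exact_mod_cast h4
    have hK' : (t : ℝ) + u = K + 1 := by exact_mod_cast hK
    push_cast at ht
    have h5 : (T.card : ℝ) = γ * (K + 1).choose t := by
      have : ((K : ℝ) + 1) * T.card = (K + 1) * (γ * (K + 1).choose t) := by
        linear_combination (K + 1 : ℝ) * h3' - h4' - ((K + 1).choose t : ℝ) * hK' -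
          ((K + 1).choose t : ℝ) * ht
      exact mul_left_cancel₀ (by positivity) this
    rw [h1, card_packet]
    simp only [Finset.card_product, Finset.card_univ, Fintype.card_fin, Nat.cast_mul, cacheSize,
      Sum.elim_inl, h5]
    apply le_of_eq
    ring
  · have : packetCache K₁ K₂ N t q (Sum.inr g) = ∅ := by
      ext p; simp [packetCache]
    simp [this, cacheSize]

/-- For every set `σ` of `t + 1` cache-aided users, the plan sends the exclusive or of the packets
that one user of `σ` wants and the others store, and, to each cache-less user, a share of the
packets stored by `t` of the users of `σ`. Each stream is nulled at the users of the other
streams of its block; a stream for a cache-less user is nulled at one user of `σ` where it meets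
the exclusive or, and is stored by the other ones. -/
theorem nonempty_deliveryPlan {K₁ K₂ N L t u : ℕ} {γ : ℝ} (hK : t + u = K₁) (hu : 0 < u)
    (ht : (K₁ : ℝ) * γ = t) (hL : 1 ≤ L) (ha : L * u ≤ u + K₂ * (t + 1))
    (hb : K₂ ≠ 0 → L * (t + 1) ≤ u + K₂ * (t + 1))
    {h : User K₁ K₂ → EuclideanSpace ℂ (Fin L)} (hh : GeneralPosition h) :
    Nonempty (DeliveryPlan N γ h (Packet K₁ t (L * u))
      (Packet K₁ (t + 1) (u + K₂ * (t + 1)))) := by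
  classical
  obtain ⟨E, hE1, hE2⟩ := exists_schedule (a := L * u) (b := L * (t + 1)) (K := K₂) (L := L)
    (ℓ := u + K₂ * (t + 1)) (by ring) ha hb
  obtain ⟨rem, pos, hrem, hpos⟩ := exists_packet_labelling (L := L) hK hu
  have hnull : ∀ s : Finset (User K₁ K₂), ∃ v : EuclideanSpace ℂ (Fin L), s.card + 1 = L →
      (∀ k ∈ s, inner ℂ (h k) v = 0) ∧ ∀ k, k ∉ s → inner ℂ (h k) v ≠ 0 := by
    intro s
    by_cases hs : s.card + 1 = L
    · obtain ⟨v, hv⟩ := hh.exists_nulling s hs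
      exact ⟨v, fun _ => hv⟩
    · exact ⟨0, fun h => absurd h hs⟩
  choose null hnull using hnull
  let Bl := Packet K₁ (t + 1) (u + K₂ * (t + 1))
  have herase : ∀ (σ : {σ : Finset (Fin K₁) // σ.card = t + 1}) (k : Fin K₁), k ∈ σ.1 →
      (σ.1.erase k).card = t := by
    intro σ k hk
    rw [Finset.card_erase_of_mem hk, σ.2]
    rfl
  let payload : Demand K₁ K₂ N → Bl × Fin L → Finset (Fin N × Packet K₁ t (L * u)) := fun d s =>
    Sum.elim
      (fun x => s.1.1.1.attach.image fun k =>
        (d (Sum.inl k.1), (⟨s.1.1.1.erase k.1, herase s.1.1 k.1 k.2⟩, x)))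
      (fun gy => {(d (Sum.inr gy.1), (⟨s.1.1.1.erase (rem s.1.1.1 gy.2),
        herase s.1.1 _ (hrem _ s.1.1.2 _)⟩, pos s.1.1.1 gy.2))})
      (E (s.2, s.1.2))
  let j0 : Fin K₁ := ⟨0, by omega⟩
  let out : Bl × Fin L → Fin K₁ := fun s =>
    Sum.elim (fun _ => j0) (fun gy => rem s.1.1.1 gy.2) (E (s.2, s.1.2))
  let rep : Bl → Fin L → Fin K₁ → User K₁ K₂ := fun β i j =>
    Sum.elim (fun _ => Sum.inl j) (fun gy => Sum.inr gy.1) (E (i, β.2))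
  have hrep : ∀ β j, Function.Injective fun i => rep β i j := by
    intro β j i i' hii
    simp only [rep] at hii
    rcases hx : E (i, β.2) with x | ⟨g, y⟩ <;> rcases hx' : E (i', β.2) with x' | ⟨g', y'⟩ <;>
      rw [hx, hx'] at hii <;> simp at hii
    · exact hE1 _ _ _ _ _ hx hx'
    · subst hii
      exact hE2 _ _ _ _ _ _ hx hx'
  let nul : Bl × Fin L → Finset (User K₁ K₂) := fun s =>
    (Finset.univ.erase s.2).image fun i => rep s.1 i (out s)
  have hnul : ∀ s, (nul s).card + 1 = L := by
    intro s
    rw [Finset.card_image_of_injective _ (hrep _ _), Finset.card_erase_of_mem (Finset.mem_univ _),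
      Finset.card_univ, Fintype.card_fin]
    omega
  have hmem : ∀ (β : Bl) (i i' : Fin L), i' ≠ i → rep β i' (out (β, i)) ∈ nul (β, i) :=
    fun β i i' hi => Finset.mem_image_of_mem _ (Finset.mem_erase.2 ⟨hi, Finset.mem_univ _⟩)
  refine ⟨⟨packetCache K₁ K₂ N t (L * u), card_packetCache_le hK ht, payload,
    fun _ s => null (nul s), fun d k p => ?_⟩⟩
  rcases k with k | g
  · obtain ⟨⟨τ, hτ⟩, x⟩ := p
    obtain ⟨⟨i, s⟩, his⟩ := E.surjective (Sum.inl x)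
    by_cases hk : k ∈ τ
    · obtain ⟨σ, -, hσ⟩ := Finset.exists_subset_card_eq
        (show t + 1 ≤ (Finset.univ : Finset (Fin K₁)).card by
          rw [Finset.card_univ, Fintype.card_fin]; omega)
      refine ⟨((⟨σ, hσ⟩, s), i), fun hnot => absurd ?_ hnot⟩
      simp [packetCache, hk]
    have hσ : (insert k τ).card = t + 1 := by rw [Finset.card_insert_of_notMem hk, hτ]
    refine ⟨((⟨insert k τ, hσ⟩, s), i), fun _ => ⟨?_, ?_, ?_, ?_⟩⟩
    · simp only [payload, his, Sum.elim_inl, Finset.mem_image, Finset.mem_attach, true_and,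
        Subtype.exists]
      refine ⟨k, Finset.mem_insert_self _ _, ?_⟩
      simp only [Finset.erase_insert hk]
    · intro q hq hne
      simp only [payload, his, Sum.elim_inl, Finset.mem_image, Finset.mem_attach, true_and,
        Subtype.exists] at hq
      obtain ⟨k', hk', rfl⟩ := hq
      have hkk : k ≠ k' := by
        rintro rfl
        exact hne (by simp only [Finset.erase_insert hk])
      simp [packetCache, hkk]
    · refine (hnull _ (hnul _)).2 _ fun hin => ?_
      simp only [nul, Finset.mem_image, Finset.mem_erase, Finset.mem_univ, and_true] at hin
      obtain ⟨i', hi', hr⟩ := hin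
      simp only [rep] at hr
      rcases hx : E (i', s) with x' | ⟨g, y⟩ <;> rw [hx] at hr <;> simp at hr
      exact hi' (hE1 _ _ _ _ _ hx his)
    · intro i' hi'
      rcases hx : E (i', s) with x' | ⟨g, y⟩
      · exact absurd (hE1 _ _ _ _ _ hx his) hi'
      · by_cases hky : rem (insert k τ) y = k
        · left
          refine (hnull _ (hnul _)).1 _ ?_
          have := hmem (⟨insert k τ, hσ⟩, s) i' i (Ne.symm hi')
          simpa [rep, out, his, hx, hky] using this
        · right
          intro q hq
          simp only [payload, hx, Sum.elim_inr, Finset.mem_singleton] at hq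
          subst hq
          simp [packetCache, Ne.symm hky]
  · obtain ⟨⟨τ, hτ⟩, x⟩ := p
    obtain ⟨σ, hσ, y, rfl, rfl⟩ := hpos τ hτ x
    obtain ⟨⟨i, s⟩, his⟩ := E.surjective (Sum.inr (g, y))
    refine ⟨((⟨σ, hσ⟩, s), i), fun _ => ⟨?_, ?_, ?_, ?_⟩⟩
    · simp [payload, his]
    · intro q hq hne
      simp only [payload, his, Sum.elim_inr, Finset.mem_singleton] at hq
      exact absurd hq hne
    · refine (hnull _ (hnul _)).2 _ fun hin => ?_
      simp only [nul, Finset.mem_image, Finset.mem_erase, Finset.mem_univ, and_true] at hin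
      obtain ⟨i', hi', hr⟩ := hin
      simp only [rep] at hr
      rcases hx : E (i', s) with x' | ⟨g', y'⟩ <;> rw [hx] at hr <;> simp at hr
      subst hr
      exact hi' (hE2 _ _ _ _ _ _ hx his)
    · intro i' hi'
      left
      refine (hnull _ (hnul _)).1 _ ?_
      have := hmem (⟨σ, hσ⟩, s) i' i (Ne.symm hi')
      simpa [rep, his] using this

theorem singleDelay_eq_div {K t u : ℕ} {γ : ℝ} (hK : t + u = K) (ht : (K : ℝ) * γ = t) :
    singleDelay K γ = u / (t + 1) := by
  have hK' : (t : ℝ) + u = K := by exact_mod_cast hK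
  unfold singleDelay
  rw [mul_sub, mul_one, ht, ← hK']
  ring_nf

/-- The optimal delay is `(K₂ + T_{K₁}) / L`, as long as the cache-less users can fill the
`L - 1` further antennas, and none of them needs to be served by two antennas at once. -/
theorem isOptimalDelay_of_le {K₁ K₂ N L t u : ℕ} {γ : ℝ} (hK : t + u = K₁) (hu : 0 < u)
    (ht : (K₁ : ℝ) * γ = t) (hγ0 : 0 ≤ γ) (hγ1 : γ ≤ 1) (hN : K₁ + K₂ ≤ N) (hL : 1 ≤ L)
    (ha : L * u ≤ u + K₂ * (t + 1)) (hb : K₂ ≠ 0 → L * (t + 1) ≤ u + K₂ * (t + 1))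
    {h : User K₁ K₂ → EuclideanSpace ℂ (Fin L)} (hh : GeneralPosition h) :
    IsOptimalDelay N γ h ((K₂ + singleDelay K₁ γ) / L) := by
  intro δ hδ
  obtain ⟨D⟩ := nonempty_deliveryPlan (N := N) hK hu ht hL ha hb hh
  have hL0 : (0 : ℝ) < L := by exact_mod_cast hL
  have hchoose : 0 < K₁.choose t := Nat.choose_pos (by omega)
  have hcard : 0 < Fintype.card (Packet K₁ t (L * u)) := by
    rw [card_packet]
    exact Nat.mul_pos hchoose (Nat.mul_pos hL hu)
  have : Nonempty (Packet K₁ t (L * u)) := Fintype.card_pos_iff.1 hcard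
  have hratio : (Fintype.card (Packet K₁ (t + 1) (u + K₂ * (t + 1))) : ℝ) /
      Fintype.card (Packet K₁ t (L * u)) = (K₂ + singleDelay K₁ γ) / L := by
    have h1 := Nat.choose_succ_right_eq K₁ t
    rw [show K₁ - t = u by omega] at h1
    have h2 : (K₁.choose (t + 1) : ℝ) * (t + 1) = K₁.choose t * u := by exact_mod_cast h1
    have hu' : (0 : ℝ) < u := by exact_mod_cast hu
    have hc' : (0 : ℝ) < K₁.choose t := by exact_mod_cast hchoose
    rw [card_packet, card_packet, singleDelay_eq_div hK ht]
    push_cast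
    rw [div_eq_div_iff (by positivity) (by positivity)]
    field_simp
    linear_combination ((u : ℝ) + K₂ * (t + 1)) * h2
  set Δ₀ : ℝ := (K₂ + singleDelay K₁ γ) / L with hΔ₀
  have hΔ₀0 : 0 ≤ Δ₀ := by rw [← hratio]; positivity
  have hδ' : 0 < δ / (Δ₀ + 1) := by positivity
  filter_upwards [D.eventually_achievableAt hδ',
    eventually_le_of_achievableAt hγ0 hγ1 hN (by omega) hL h hδ] with P h1 h2
  refine ⟨⟨_, h1, ?_⟩, h2⟩
  rw [hratio]
  have : δ / (Δ₀ + 1) * Δ₀ ≤ δ := by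
    rw [div_mul_eq_mul_div, div_le_iff₀ (by positivity)]
    nlinarith
  linarith

end Plan

end CacheMISO

end

theorem theorem3 (K₁ K₂ N L : ℕ) (γ₁ Lt : ℝ)
    (hK₁ : 0 < K₁) (hγ₀ : 0 < γ₁) (hγ₁ : γ₁ < 1) (hint : ∃ t : ℕ, (K₁ : ℝ) * γ₁ = t)
    (hN : K₁ + K₂ ≤ N)
    (hK₂ : (K₂ : ℝ) = (Lt - 1) * CacheMISO.singleDelay K₁ γ₁)
    (hL : 1 ≤ L) (hLt : (L : ℝ) ≤ Lt)
    (hdelay : L = 1 ∨ (L : ℝ) ≤ CacheMISO.singleDelay K₁ γ₁ * Lt)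
    (h₁ : CacheMISO.User K₁ K₂ → EuclideanSpace ℂ (Fin 1)) (hh₁ : CacheMISO.GeneralPosition h₁)
    (h : CacheMISO.User K₁ K₂ → EuclideanSpace ℂ (Fin L)) (hh : CacheMISO.GeneralPosition h) :
    ∃ D₁ D : ℝ,
      CacheMISO.IsOptimalDelay N γ₁ h₁ D₁ ∧
      CacheMISO.IsOptimalDelay N γ₁ h D ∧
      D₁ = L * D ∧
      D = CacheMISO.singleDelay K₁ γ₁ * Lt / L := by
  obtain ⟨t, ht⟩ := hint
  have hK₁' : (0 : ℝ) < K₁ := by exact_mod_cast hK₁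
  have htK : t < K₁ := by
    have : (t : ℝ) < K₁ := by rw [← ht]; nlinarith
    exact_mod_cast this
  obtain ⟨u, hK⟩ : ∃ u, t + u = K₁ := ⟨K₁ - t, by omega⟩
  have hu : 0 < u := by omega
  have hu' : (0 : ℝ) < u := by exact_mod_cast hu
  have hT := CacheMISO.singleDelay_eq_div hK ht
  set T := CacheMISO.singleDelay K₁ γ₁ with hTdef
  have hTu : T * (t + 1) = u := by rw [hT]; field_simp
  have hL0 : (0 : ℝ) < L := by exact_mod_cast hL
  have hTLt : T * Lt = K₂ + T := by rw [hK₂]; ring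
  have hle1 : ∀ M : ℕ, K₂ ≠ 0 → M = 1 → M * (t + 1) ≤ u + K₂ * (t + 1) := by
    rintro M h0 rfl
    have : 1 * (t + 1) ≤ K₂ * (t + 1) := Nat.mul_le_mul_right _ (by omega)
    omega
  have opt₁ := CacheMISO.isOptimalDelay_of_le (N := N) (L := 1) hK hu ht hγ₀.le hγ₁.le hN le_rfl
    (by omega) (fun h0 => hle1 1 h0 rfl) hh₁
  have opt := CacheMISO.isOptimalDelay_of_le (N := N) hK hu ht hγ₀.le hγ₁.le hN hL
    (by
      have : (L : ℝ) * u ≤ u + K₂ * (t + 1) := by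
        have h1 : (K₂ : ℝ) * (t + 1) = (Lt - 1) * u := by rw [hK₂, ← hTu]; ring
        rw [h1]; nlinarith
      exact_mod_cast this)
    (fun h0 => by
      rcases hdelay with h1 | h1
      · exact hle1 L h0 h1
      · have : (L : ℝ) * (t + 1) ≤ u + K₂ * (t + 1) := by
          rw [hTLt] at h1
          have h2 : (L : ℝ) * (t + 1) ≤ (K₂ + T) * (t + 1) := by gcongr
          linarith
        exact_mod_cast this) hh
  refine ⟨_, _, opt₁, opt, ?_, ?_⟩
  · push_cast
    field_simp
  · rw [hTLt]
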